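/- Let $F$ be a nonarchimedean local field of characteristic $0$ and let $(V,q)$ be a nondegenerate quadratic space over $F$ of finite dimension $n$; write $n=2k$ or $n=2k-1$, i.e. $k=\lfloor (n+1)/2\rfloor$. Let $C(V)=T(V)/\langle v\otimes v-q(v)\cdot 1 : v\in V\rangle$ be the Clifford algebra, $C^{+}(V)$ and $C^{-}(V)$ its even and odd parts, $\alpha$ the automorphism of $C(V)$ acting as $+1$ on $C^{+}(V)$ and $-1$ on $C^{-}(V)$, and $x\mapsto x^{*}$ the canonical involution, $(v_1v_2\cdots v_\ell)^{*}=v_\ell\cdots v_2v_1$ for $v_i\in V$. Put $$\mathrm{GPin}(V)=\{g\in C(V)^\times : \alpha(g)Vg^{-1}=V\},\qquad \mathrm{GSpin}(V)=\{g\in C^{+}(V)^\times : gVg^{-1}=V\}\subseteq \mathrm{GPin}(V),$$ let $\mathrm{sign}:\mathrm{GPin}(V)\to\{\pm1\}$ be $+1$ on $\mathrm{GSpin}(V)$ and $-1$ on its complement, and let $\sigma_V:\mathrm{GPin}(V)\to\mathrm{GPin}(V)$ be the involution $\sigma_V(g)=g^{*}$ if $n=2k$, and $\sigma_V(g)=\mathrm{sign}(g)^{k+1}g^{*}$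 if $n=2k-1$. Let $g\in\mathrm{GSpin}(V)$ be semisimple (as an element of the linear algebraic group, i.e. left multiplication by $g$ on $C(V)$ is a semisimple endomorphism). Then: (1) For every anisotropic vector $e\in V$ (that is, $q(e)\neq 0$, so that $e\in \mathrm{GPin}(V)$), $g$ is conjugate within $\mathrm{GSpin}(V)$ to $e^{k}\sigma_V(g)e^{-k}$: there is $\eta\in\mathrm{GSpin}(V)$ with $\eta\, e^{k}\sigma_V(g)e^{-k}\,\eta^{-1}=g$. (2) If $n=2k-1$ is odd, then $g$ is conjugate within $\mathrm{GSpin}(V)$ to $\sigma_V(g)$: there is $\eta\in\mathrm{GSpin}(V)$ with $\eta\,\sigma_V(g)\,\eta^{-1}=g$. -/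

import Mathlib

open CliffordAlgebra

noncomputable section

namespace CliffordGroups

/-- The integer `k` with `n = 2k` or `n = 2k - 1`, i.e. `k = ⌊(n + 1) / 2⌋`,
where `n = dim V`. -/
def halfDim (F V : Type*) [Field F] [AddCommGroup V] [Module F V] : ℕ :=
  (Module.finrank F V + 1) / 2

variable {F V : Type*} [Field F] [AddCommGroup V] [Module F V]

/-- The copy of `V` inside the Clifford algebra `C(V)`. -/
def vectors (Q : QuadraticForm F V) : Set (CliffordAlgebra Q) := Set.range (ι Q)

/-- The map `x ↦ α(g) x g⁻¹` on the Clifford algebra, where `α` is the grading automorphism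
(`+1` on even elements and `-1` on odd elements). -/
def twistedConj {Q : QuadraticForm F V} (g : (CliffordAlgebra Q)ˣ) (x : CliffordAlgebra Q) :
    CliffordAlgebra Q :=
  involute (g : CliffordAlgebra Q) * x * ((g⁻¹ : (CliffordAlgebra Q)ˣ) : CliffordAlgebra Q)

theorem twistedConj_one {Q : QuadraticForm F V} (x : CliffordAlgebra Q) :
    twistedConj 1 x = x := by
  simp [twistedConj]

theorem twistedConj_mul {Q : QuadraticForm F V} (g h : (CliffordAlgebra Q)ˣ)
    (x : CliffordAlgebra Q) : twistedConj (g * h) x = twistedConj g (twistedConj h x) := by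
  simp [twistedConj, mul_assoc]

/-- The general Pin group `GPin(V) = {g ∈ C(V)ˣ : α(g) V g⁻¹ = V}`. -/
def GPin (Q : QuadraticForm F V) : Subgroup (CliffordAlgebra Q)ˣ where
  carrier := {g | twistedConj g '' vectors Q = vectors Q}
  one_mem' := by
    have : twistedConj (1 : (CliffordAlgebra Q)ˣ) = id := funext twistedConj_one
    simp [this]
  mul_mem' {g h} hg hh := by
    have : twistedConj (g * h) = twistedConj g ∘ twistedConj h := funext (twistedConj_mul g h)
    simp only [Set.mem_ofPred_eq] at hg hh ⊢
    rw [this, Set.image_comp, hh, hg]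
  inv_mem' {g} hg := by
    have : twistedConj g⁻¹ ∘ twistedConj g = id := by
      funext x
      rw [Function.comp_apply, ← twistedConj_mul, inv_mul_cancel, twistedConj_one, id]
    simp only [Set.mem_ofPred_eq] at hg ⊢
    conv_lhs => rw [← hg]
    rw [← Set.image_comp, this, Set.image_id]

theorem mem_GPin_of {Q : QuadraticForm F V} {g : (CliffordAlgebra Q)ˣ}
    (h1 : ∀ x ∈ vectors Q, twistedConj g x ∈ vectors Q)
    (h2 : ∀ x ∈ vectors Q, twistedConj g⁻¹ x ∈ vectors Q) : g ∈ GPin Q := by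
  refine Set.Subset.antisymm ?_ ?_
  · rintro _ ⟨x, hx, rfl⟩
    exact h1 x hx
  · intro x hx
    refine ⟨_, h2 x hx, ?_⟩
    rw [← twistedConj_mul, mul_inv_cancel, twistedConj_one]

theorem twistedConj_mem {Q : QuadraticForm F V} {g : (CliffordAlgebra Q)ˣ} (hg : g ∈ GPin Q)
    {x : CliffordAlgebra Q} (hx : x ∈ vectors Q) : twistedConj g x ∈ vectors Q := by
  have h : twistedConj g '' vectors Q = vectors Q := hg
  rw [← h]
  exact ⟨x, hx, rfl⟩

/-- The general Spin group `GSpin(V) = {g ∈ C⁺(V)ˣ : g V g⁻¹ = V}`; a unit of the even Clifford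
algebra `C⁺(V)` is a unit of `C(V)` which lies in `C⁺(V)` together with its inverse. -/
def GSpin (Q : QuadraticForm F V) : Subgroup (CliffordAlgebra Q)ˣ where
  carrier := {g | (g : CliffordAlgebra Q) ∈ even Q ∧
    ((g⁻¹ : (CliffordAlgebra Q)ˣ) : CliffordAlgebra Q) ∈ even Q ∧
    (fun x : CliffordAlgebra Q => (g : CliffordAlgebra Q) * x *
      ((g⁻¹ : (CliffordAlgebra Q)ˣ) : CliffordAlgebra Q)) '' vectors Q = vectors Q}
  one_mem' := by
    refine ⟨by simp, by simp, by simp⟩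
  mul_mem' {g h} hg hh := by
    obtain ⟨g1, g2, g3⟩ := hg
    obtain ⟨h1, h2, h3⟩ := hh
    refine ⟨by simpa using mul_mem g1 h1, by simpa using mul_mem h2 g2, ?_⟩
    conv_rhs => rw [← g3, ← h3]
    rw [← Set.image_comp]
    refine Set.image_congr fun x _ => ?_
    simp [mul_assoc]
  inv_mem' {g} hg := by
    obtain ⟨g1, g2, g3⟩ := hg
    refine ⟨g2, by simpa using g1, ?_⟩
    conv_lhs => rw [← g3]
    rw [← Set.image_comp]
    conv_rhs => rw [← Set.image_id (vectors Q)]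
    refine Set.image_congr fun x _ => ?_
    simp [mul_assoc]

theorem GSpin_le_GPin (Q : QuadraticForm F V) : GSpin Q ≤ GPin Q := by
  intro g hg
  obtain ⟨g1, -, g3⟩ := hg
  have h : involute (g : CliffordAlgebra Q) = g := involute_eq_of_mem_even g1
  change twistedConj g '' vectors Q = vectors Q
  conv_rhs => rw [← g3]
  refine Set.image_congr fun x _ => ?_
  rw [twistedConj, h]

/-- The sign character of `GPin(V)`: `+1` on `GSpin(V)` and `-1` on its complement. -/
def sign {Q : QuadraticForm F V} (g : GPin Q) : ℤˣ :=
  open Classical in if (g : (CliffordAlgebra Q)ˣ) ∈ GSpin Q then 1 else -1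

/-- The canonical involution `v₁ v₂ ⋯ vₗ ↦ vₗ ⋯ v₂ v₁` on the units of the Clifford algebra. -/
def starUnit {Q : QuadraticForm F V} (g : (CliffordAlgebra Q)ˣ) : (CliffordAlgebra Q)ˣ where
  val := reverse (g : CliffordAlgebra Q)
  inv := reverse ((g⁻¹ : (CliffordAlgebra Q)ˣ) : CliffordAlgebra Q)
  val_inv := by rw [← reverse.map_mul, Units.inv_mul, reverse.map_one]
  inv_val := by rw [← reverse.map_mul, Units.mul_inv, reverse.map_one]

theorem twistedConj_starUnit {Q : QuadraticForm F V} (g : (CliffordAlgebra Q)ˣ) (v : V) :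
    twistedConj (starUnit g) (ι Q v) = involute (reverse (-(twistedConj g⁻¹ (ι Q v)))) := by
  have h : ((starUnit g)⁻¹ : (CliffordAlgebra Q)ˣ).val =
    reverse ((g⁻¹ : (CliffordAlgebra Q)ˣ) : CliffordAlgebra Q) := rfl
  have h' : (starUnit g).val = reverse (g : CliffordAlgebra Q) := rfl
  simp [twistedConj, h, h', reverse_involute, reverse.map_mul, mul_assoc]

theorem starUnit_mem {Q : QuadraticForm F V} {g : (CliffordAlgebra Q)ˣ} (hg : g ∈ GPin Q) :
    starUnit g ∈ GPin Q := by
  have key : ∀ g ∈ GPin Q, ∀ x ∈ vectors Q, twistedConj (starUnit g) x ∈ vectors Q := by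
    rintro g hg _ ⟨v, rfl⟩
    obtain ⟨w, hw⟩ := twistedConj_mem (inv_mem hg) (x := ι Q v) ⟨v, rfl⟩
    rw [twistedConj_starUnit, ← hw]
    exact ⟨w, by simp⟩
  refine mem_GPin_of (key g hg) ?_
  have : (starUnit g)⁻¹ = starUnit g⁻¹ := by ext; rfl
  rw [this]
  exact key _ (inv_mem hg)

/-- The sign `±1`, viewed as an element of `GPin(V)`. -/
def signUnit (Q : QuadraticForm F V) (s : ℤˣ) : (CliffordAlgebra Q)ˣ :=
  Units.map (Int.castRingHom (CliffordAlgebra Q)).toMonoidHom s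

theorem signUnit_mem (Q : QuadraticForm F V) (s : ℤˣ) : signUnit Q s ∈ GPin Q := by
  have : ∀ x, twistedConj (signUnit Q s) x = x := by
    intro x
    rcases Int.units_eq_one_or s with rfl | rfl <;> simp [twistedConj, signUnit]
  have h : twistedConj (signUnit Q s) = id := funext this
  change twistedConj (signUnit Q s) '' vectors Q = vectors Q
  rw [h, Set.image_id]

/-- The involution `σ_V` of `GPin(V)`: it is `g ↦ g^*` if `n = 2k`, and
`g ↦ sign(g)^(k+1) g^*` if `n = 2k - 1`. -/
def sigma {Q : QuadraticForm F V} (g : GPin Q) : GPin Q :=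
  if Even (Module.finrank F V) then ⟨starUnit g, starUnit_mem g.2⟩
  else ⟨signUnit Q (sign g ^ (halfDim F V + 1)) * starUnit g,
    mul_mem (signUnit_mem Q _) (starUnit_mem g.2)⟩

/-- An anisotropic vector `e`, viewed as a unit of the Clifford algebra, with inverse
`q(e)⁻¹ e`. -/
def vecUnit {Q : QuadraticForm F V} (e : V) (he : Q e ≠ 0) : (CliffordAlgebra Q)ˣ where
  val := ι Q e
  inv := (Q e)⁻¹ • ι Q e
  val_inv := by
    rw [mul_smul_comm, ι_sq_scalar, Algebra.algebraMap_eq_smul_one, smul_smul,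
      inv_mul_cancel₀ he, one_smul]
  inv_val := by
    rw [smul_mul_assoc, ι_sq_scalar, Algebra.algebraMap_eq_smul_one, smul_smul,
      inv_mul_cancel₀ he, one_smul]

theorem vecUnit_mem {Q : QuadraticForm F V} (e : V) (he : Q e ≠ 0) : vecUnit e he ∈ GPin Q := by
  refine mem_GPin_of ?_ ?_
  · rintro _ ⟨v, rfl⟩
    refine ⟨-((Q e)⁻¹ • ((QuadraticMap.polar Q e v) • e - Q e • v)), ?_⟩
    have h : ((vecUnit e he)⁻¹ : (CliffordAlgebra Q)ˣ).val = (Q e)⁻¹ • ι Q e := rfl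
    have h' : (vecUnit e he).val = ι Q e := rfl
    rw [twistedConj, h, h', involute_ι, mul_smul_comm, neg_mul, neg_mul, ι_mul_ι_mul_ι]
    simp [← smul_neg]
  · rintro _ ⟨v, rfl⟩
    refine ⟨-((Q e)⁻¹ • ((QuadraticMap.polar Q e v) • e - Q e • v)), ?_⟩
    have h : ((vecUnit e he)⁻¹ : (CliffordAlgebra Q)ˣ).val = (Q e)⁻¹ • ι Q e := rfl
    have h' : (vecUnit e he).val = ι Q e := rfl
    rw [twistedConj, inv_inv, h, h', map_smul, involute_ι, smul_mul_assoc, smul_mul_assoc,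
      neg_mul, neg_mul, ι_mul_ι_mul_ι]
    simp [← smul_neg]

/-- An anisotropic vector, viewed as an element of `GPin(V)`. -/
def vec {Q : QuadraticForm F V} (e : V) (he : Q e ≠ 0) : GPin Q := ⟨vecUnit e he, vecUnit_mem e he⟩

/-- `GSpin(V)` as a subgroup of `GPin(V)`. -/
def GSpinInGPin (Q : QuadraticForm F V) : Subgroup (GPin Q) := (GSpin Q).subgroupOf (GPin Q)

/-- Semisimple elements of the linear algebraic group `GPin(V)` (over a field of characteristic
zero): left multiplication by `g` on `C(V)` is a semisimple endomorphism. The left regular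
representation of `C(V)ˣ` is a faithful algebraic representation, and semisimplicity of an element
of a linear algebraic group may be tested on any such representation; over a perfect field a
semisimple endomorphism is one that is diagonalizable over an algebraic closure. -/
def IsSemisimpleElt {Q : QuadraticForm F V} (g : GPin Q) : Prop :=
  Module.End.IsSemisimple (LinearMap.mulLeft F ((g : (CliffordAlgebra Q)ˣ) : CliffordAlgebra Q))

end CliffordGroups

end

/-! The claim reduces to an isometry being a product of two involutions of controlled type. An
element `g` of GSpin induces an isometry `T` of V. If `T` is the product of reflections along a list
of anisotropic vectors, then `g` is a scalar times their Clifford product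
(`exists_eq_smul_vecProd`), because an element commuting with all vectors in the twisted sense is a
scalar. Suppose `T` is a product of two involutions whose (-1)-eigenspaces both have dimension k.
Multiplying orthogonal bases of these eigenspaces gives `g = c A B`, where A and B are products of k
pairwise orthogonal vectors. Reversal multiplies A and B by the same sign, so `g* = c B A` and `A g*
= g A`. The conjugator A has parity k: dividing by `e^k` makes it even, and in odd dimension an odd
central element can repair the parity instead.

The two involutions come from an orthogonal decomposition of V (`exists_hasInvolutionFactors`). It
consists of p lines where `T = 1`, r lines where `T = -1`, and cyclic subspaces of total dimension
2m without eigenvalues 1 or -1. On a cyclic subspace, the map `h` sending `T^i v` to `T^(-i) v` is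
an isometric involution and `T = h (h T)`; both factors anticommute with `T - T⁻¹`, so their
(-1)-eigenspaces have half the dimension. A line with `T = -1` contributes a reflection to exactly
one factor, the choice being free; a line with `T = 1` contributes to both or to neither. Since `g`
is even, r is even, and the choices can be balanced so that both dimensions equal k. Semisimplicity
of `T`, inherited from that of left multiplication by `g`, is what makes the summands nondegenerate.
-/

open CliffordAlgebra

noncomputable section

namespace CliffordGroups

variable {F V : Type*} [Field F] [AddCommGroup V] [Module F V]

/-! ### Products of reflections and products of vectors -/

/-- The reflection along `a` with respect to the bilinear form `B`. -/
def reflect (B : LinearMap.BilinForm F V) (a : V) : Module.End F V :=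
  LinearMap.id - (2 / B a a) • (B a).smulRight a

theorem reflect_apply (B : LinearMap.BilinForm F V) (a v : V) :
    reflect B a v = v - (2 / B a a * B a v) • a := by
  simp [reflect, smul_smul]

/-- The product of the reflections along the vectors of a list. -/
def reflectProd (B : LinearMap.BilinForm F V) (l : List V) : Module.End F V :=
  (l.map (reflect B)).prod

@[simp] theorem reflectProd_nil (B : LinearMap.BilinForm F V) (v : V) :
    reflectProd B [] v = v := by simp [reflectProd]

@[simp] theorem reflectProd_cons (B : LinearMap.BilinForm F V) (a : V) (l : List V) (v : V) :
    reflectProd B (a :: l) v = reflect B a (reflectProd B l v) := by simp [reflectProd]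

theorem reflectProd_append (B : LinearMap.BilinForm F V) (a b : List V) (v : V) :
    reflectProd B (a ++ b) v = reflectProd B a (reflectProd B b v) := by simp [reflectProd]

/-- The product in the Clifford algebra of the vectors of a list. -/
def vecProd (Q : QuadraticForm F V) (l : List V) : CliffordAlgebra Q := (l.map (ι Q)).prod

@[simp] theorem vecProd_nil (Q : QuadraticForm F V) : vecProd Q [] = 1 := by simp [vecProd]

@[simp] theorem vecProd_cons (Q : QuadraticForm F V) (a : V) (l : List V) :
    vecProd Q (a :: l) = ι Q a * vecProd Q l := by simp [vecProd]

@[simp] theorem vecProd_append (Q : QuadraticForm F V) (a b : List V) :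
    vecProd Q (a ++ b) = vecProd Q a * vecProd Q b := by simp [vecProd]

/-! ### Clifford relations and the twisted centre -/

section Clifford

variable {Q : QuadraticForm F V} {B : LinearMap.BilinForm F V}

theorem ι_mul_ι_eq (hB : ∀ x y, B x y = B y x) (hBQ : ∀ v, B v v = Q v) (a b : V) :
    ι Q a * ι Q b = algebraMap F _ (2 * B a b) - ι Q b * ι Q a := by
  have h := ι_mul_ι_add_swap (Q := Q) a b
  have : QuadraticMap.polar Q a b = 2 * B a b := by
    rw [QuadraticMap.polar, ← hBQ, ← hBQ, ← hBQ]
    simp only [map_add, LinearMap.add_apply]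
    rw [hB b a]; ring
  rw [← this, ← h]; abel

theorem ι_mul_ι_of_ortho (hB : ∀ x y, B x y = B y x) (hBQ : ∀ v, B v v = Q v) {a b : V}
    (h : B a b = 0) : ι Q a * ι Q b = - (ι Q b * ι Q a) := by
  rw [ι_mul_ι_eq hB hBQ, h]; simp

/-- Twisted conjugation by an anisotropic vector is the reflection along it; the twist by `involute`
removes the sign that plain conjugation would carry. -/
theorem involute_vecProd_mul_ι (hB : ∀ x y, B x y = B y x) (hBQ : ∀ v, B v v = Q v)
    (l : List V) (hl : ∀ a ∈ l, B a a ≠ 0) (v : V) :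
    involute (vecProd Q l) * ι Q v = ι Q (reflectProd B l v) * vecProd Q l := by
  induction l with
  | nil => simp
  | cons a l ih =>
    have ha : B a a ≠ 0 := hl a (by simp)
    have ih := ih fun x hx => hl x (by simp [hx])
    set w := reflectProd B l v with hw
    have key : - ι Q a * ι Q w = ι Q (reflect B a w) * ι Q a := by
      rw [reflect_apply, map_sub, map_smul, sub_mul, smul_mul_assoc, ι_sq_scalar, ← hBQ, neg_mul,
        ι_mul_ι_eq hB hBQ, neg_sub, Algebra.smul_def,
        ← map_mul (algebraMap F (CliffordAlgebra Q))]
      congr 2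
      field_simp
    rw [vecProd_cons, map_mul, involute_ι, mul_assoc, ih, reflectProd_cons, ← hw, ← mul_assoc, key,
      mul_assoc]

theorem involute_vecProd (l : List V) :
    involute (vecProd Q l) = (-1 : F) ^ l.length • vecProd Q l := involute_prod_map_ι l

theorem ι_mul_vecProd_of_ortho (hB : ∀ x y, B x y = B y x) (hBQ : ∀ v, B v v = Q v) (a : V)
    (l : List V) (h : ∀ b ∈ l, B a b = 0) :
    ι Q a * vecProd Q l = (-1 : F) ^ l.length • (vecProd Q l * ι Q a) := by
  induction l with
  | nil => simp
  | cons b l ih =>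
    rw [vecProd_cons, ← mul_assoc, ι_mul_ι_of_ortho hB hBQ (h b (by simp)), neg_mul, mul_assoc,
      ih fun x hx => h x (by simp [hx]), mul_smul_comm, ← mul_assoc, List.length_cons, pow_succ,
      mul_neg_one, neg_smul]

theorem reverse_vecProd_cons (a : V) (l : List V) :
    reverse (vecProd Q (a :: l)) = reverse (vecProd Q l) * ι Q a := by
  rw [vecProd_cons, reverse.map_mul, reverse_ι]

/-- Reversing a product of `d` pairwise orthogonal vectors multiplies it by a sign which depends
only on `d`. -/
theorem reverse_vecProd (hB : ∀ x y, B x y = B y x) (hBQ : ∀ v, B v v = Q v)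
    (l : List V) (h : l.Pairwise fun a b => B a b = 0) :
    reverse (vecProd Q l) = (-1 : F) ^ (l.length.choose 2) • vecProd Q l := by
  induction l with
  | nil => simp
  | cons a l ih =>
    rw [List.pairwise_cons] at h
    have hs : ((-1 : F) ^ l.length) * (-1 : F) ^ l.length = 1 := by
      rw [← mul_pow]; simp
    -- Moving `a` back to the front past `l` costs `(-1) ^ l.length`, which matches choose(d+1, 2) =
    -- d + choose(d, 2).
    rw [reverse_vecProd_cons, ih h.2, vecProd_cons, ι_mul_vecProd_of_ortho hB hBQ a l h.1,
      smul_mul_assoc, smul_smul, List.length_cons, Nat.choose_succ_succ' l.length 1,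
      Nat.choose_one_right, pow_add, mul_right_comm, hs, one_mul]

theorem vecProd_mul_reverse_self (l : List V) :
    vecProd Q l * reverse (vecProd Q l) = algebraMap F _ (l.map Q).prod := by
  induction l with
  | nil => simp
  | cons a l ih =>
    rw [reverse_vecProd_cons, vecProd_cons, mul_assoc, ← mul_assoc (vecProd Q l), ih,
      Algebra.commutes, ← mul_assoc, ι_sq_scalar, ← map_mul, List.map_cons, List.prod_cons]

/-- The subalgebra of the Clifford algebra generated by the vectors of a list. -/
def listAlgebra (Q : QuadraticForm F V) (l : List V) : Subalgebra F (CliffordAlgebra Q) :=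
  Algebra.adjoin F {x | ∃ a ∈ l, ι Q a = x}

theorem ι_mul_of_mem_listAlgebra (hB : ∀ x y, B x y = B y x) (hBQ : ∀ v, B v v = Q v) {e : V}
    {l : List V} (h : ∀ b ∈ l, B e b = 0) {y : CliffordAlgebra Q} (hy : y ∈ listAlgebra Q l) :
    ι Q e * y = involute y * ι Q e := by
  induction hy using Algebra.adjoin_induction with
  | mem x hx =>
    obtain ⟨a, ha, rfl⟩ := hx
    rw [involute_ι, neg_mul, ι_mul_ι_of_ortho hB hBQ (h a ha)]
  | algebraMap r => rw [AlgHom.commutes, Algebra.commutes]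
  | add x y _ _ hx hy => rw [mul_add, hx, hy, map_add, add_mul]
  | mul x y _ _ hx hy => rw [← mul_assoc, hx, mul_assoc, hy, map_mul, mul_assoc]

theorem involute_mem_listAlgebra {l : List V} {y : CliffordAlgebra Q} (hy : y ∈ listAlgebra Q l) :
    involute y ∈ listAlgebra Q l := by
  induction hy using Algebra.adjoin_induction with
  | mem x hx =>
    obtain ⟨a, ha, rfl⟩ := hx
    rw [involute_ι]
    exact neg_mem (Algebra.subset_adjoin ⟨a, ha, rfl⟩)
  | algebraMap r => rw [AlgHom.commutes]; exact algebraMap_mem _ r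
  | add x y _ _ hx hy => rw [map_add]; exact add_mem hx hy
  | mul x y _ _ hx hy => rw [map_mul]; exact mul_mem hx hy

/-- Elements of this form are closed under multiplication: `e` moves past the algebra of `l` through
`involute`, and `e²` is the scalar `Q e`. -/
theorem exists_eq_add_mul_ι (hB : ∀ x y, B x y = B y x) (hBQ : ∀ v, B v v = Q v) {e : V}
    {l : List V} (h : ∀ b ∈ l, B e b = 0) {x : CliffordAlgebra Q}
    (hx : x ∈ listAlgebra Q (e :: l)) :
    ∃ y ∈ listAlgebra Q l, ∃ z ∈ listAlgebra Q l, x = y + z * ι Q e := by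
  induction hx using Algebra.adjoin_induction with
  | mem x hx =>
    obtain ⟨a, ha, rfl⟩ := hx
    rcases List.mem_cons.1 ha with rfl | ha
    · exact ⟨0, zero_mem _, 1, one_mem _, by simp⟩
    · exact ⟨ι Q a, Algebra.subset_adjoin ⟨a, ha, rfl⟩, 0, zero_mem _, by simp⟩
  | algebraMap r => exact ⟨_, algebraMap_mem _ r, 0, zero_mem _, by simp⟩
  | add _ _ _ _ hx hx' =>
    obtain ⟨y, hy, z, hz, rfl⟩ := hx
    obtain ⟨y', hy', z', hz', rfl⟩ := hx'
    exact ⟨y + y', add_mem hy hy', z + z', add_mem hz hz', by rw [add_mul]; abel⟩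
  | mul _ _ _ _ hx hx' =>
    obtain ⟨y, hy, z, hz, rfl⟩ := hx
    obtain ⟨y', hy', z', hz', rfl⟩ := hx'
    refine ⟨y * y' + z * involute z' * algebraMap F _ (Q e),
      add_mem (mul_mem hy hy') (mul_mem (mul_mem hz (involute_mem_listAlgebra hz'))
        (algebraMap_mem _ _)), y * z' + z * involute y',
      add_mem (mul_mem hy hz') (mul_mem hz (involute_mem_listAlgebra hy')), ?_⟩
    have h1 := ι_mul_of_mem_listAlgebra hB hBQ h hy'
    have h2 := ι_mul_of_mem_listAlgebra hB hBQ h hz'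
    rw [← ι_sq_scalar]
    simp only [add_mul, mul_add, mul_assoc, h1]
    rw [← mul_assoc (ι Q e) z', h2]
    simp only [mul_assoc]
    abel

/-- Generators are eliminated one at a time: twisted commutation with `e` kills the coefficient of
`e`. The twist matters, since the ordinary centre is larger than the scalars in odd dimension. -/
theorem mem_bot_of_twisted_commute_list (h2 : (2 : F) ≠ 0) (hB : ∀ x y, B x y = B y x)
    (hBQ : ∀ v, B v v = Q v) (l : List V) (hl : ∀ a ∈ l, B a a ≠ 0)
    (hp : l.Pairwise fun a b => B a b = 0) {x : CliffordAlgebra Q} (hx : x ∈ listAlgebra Q l)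
    (h : ∀ a ∈ l, involute x * ι Q a = ι Q a * x) : ∃ c : F, x = algebraMap F _ c := by
  induction l generalizing x with
  | nil =>
    simp only [listAlgebra, List.not_mem_nil, false_and, exists_false, Set.ofPred_false,
      Algebra.adjoin_empty] at hx
    obtain ⟨c, rfl⟩ := Algebra.mem_bot.1 hx
    exact ⟨c, rfl⟩
  | cons e l ih =>
    rw [List.pairwise_cons] at hp
    obtain ⟨y, hy, z, hz, rfl⟩ := exists_eq_add_mul_ι hB hBQ hp.1 hx
    have he := h e (by simp)
    have hQe : Q e ≠ 0 := by rw [← hBQ]; exact hl e (by simp)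
    have h1 := ι_mul_of_mem_listAlgebra hB hBQ hp.1 hy
    have h3 := ι_mul_of_mem_listAlgebra hB hBQ hp.1 hz
    -- For `x = y + z e` the terms in `y` agree on both sides, and what remains is `2 Q(e) α(z) =
    -- 0`.
    have hz0 : z = 0 := by
      rw [map_add, map_mul, involute_ι, add_mul, mul_add, h1, ← mul_assoc, h3, add_right_inj,
        mul_neg, neg_mul, mul_assoc, ι_sq_scalar, neg_eq_iff_add_eq_zero, ← two_smul F,
        ← Algebra.commutes, ← Algebra.smul_def, smul_smul] at he
      have := (smul_eq_zero.1 he).resolve_left (mul_ne_zero h2 hQe)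
      rwa [map_eq_zero_iff _ involute_involutive.injective] at this
    subst hz0
    rw [zero_mul, add_zero] at h ⊢
    exact ih (fun a ha => hl a (by simp [ha])) hp.2 hy fun a ha => h a (by simp [ha])

end Clifford

/-! ### Involutive isometries and their eigenspaces -/

section LinearAlgebra

variable {B : LinearMap.BilinForm F V}

theorem reflectProd_of_ortho {l : List V} {v : V} (h : ∀ a ∈ l, B a v = 0) :
    reflectProd B l v = v := by
  induction l with
  | nil => simp
  | cons a l ih =>
    rw [reflectProd_cons, ih fun x hx => h x (by simp [hx]), reflect_apply, h a (by simp)]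
    simp

theorem reflect_self {a : V} (ha : B a a ≠ 0) : reflect B a a = -a := by
  rw [reflect_apply, div_mul_cancel₀ _ ha, two_smul]; abel

theorem reflectProd_of_mem {l : List V} (hB : ∀ x y, B x y = B y x) (hl : ∀ a ∈ l, B a a ≠ 0)
    (hp : l.Pairwise fun a b => B a b = 0) {v : V} (h : v ∈ l) : reflectProd B l v = -v := by
  induction l with
  | nil => simp at h
  | cons a l ih =>
    rw [List.pairwise_cons] at hp
    rw [reflectProd_cons]
    rcases List.mem_cons.1 h with rfl | hv
    · rw [reflectProd_of_ortho fun x hx => by rw [hB]; exact hp.1 x hx, reflect_self (hl _ h)]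
    · rw [ih (fun x hx => hl x (by simp [hx])) hp.2 hv, reflect_apply, map_neg, hp.1 v hv]
      simp

theorem reflectProd_mem {l : List V} {W : Submodule F V} (hl : ∀ a ∈ l, a ∈ W) {v : V}
    (hv : v ∈ W) : reflectProd B l v ∈ W := by
  induction l with
  | nil => simpa
  | cons a l ih =>
    rw [reflectProd_cons, reflect_apply]
    exact sub_mem (ih fun x hx => hl x (by simp [hx])) (W.smul_mem _ (hl a (by simp)))

/-- The restriction of the symmetric bilinear form `B` to the subspace `W` is nondegenerate. -/
def NondegenerateOn (B : LinearMap.BilinForm F V) (W : Submodule F V) : Prop :=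
  ∀ x ∈ W, (∀ y ∈ W, B x y = 0) → x = 0

theorem exists_orthogonal_list [FiniteDimensional F V] (h2 : (2 : F) ≠ 0)
    (hB : ∀ x y, B x y = B y x) {N : Submodule F V} (hN : NondegenerateOn B N) :
    ∃ l : List V, (∀ a ∈ l, a ∈ N ∧ B a a ≠ 0) ∧ (l.Pairwise fun a b => B a b = 0) ∧
      l.length = Module.finrank F N ∧ N = Submodule.span F {a | a ∈ l} := by
  have : Invertible (2 : F) := invertibleOfNonzero h2
  obtain ⟨v, hv⟩ := LinearMap.BilinForm.exists_orthogonal_basis (B := B.restrict N)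
    ⟨fun x y => hB x y⟩
  have hv' : ∀ i j, i ≠ j → B (v i) (v j) = 0 := fun i j hij => hv hij
  have hspan : N = Submodule.span F (Set.range fun i => (v i : V)) := by
    have := congrArg (Submodule.map N.subtype) v.span_eq
    rw [Submodule.map_span, ← Set.range_comp, Submodule.map_top, Submodule.range_subtype] at this
    exact this.symm
  refine ⟨List.ofFn fun i => (v i : V), ?_, ?_, by simp, ?_⟩
  · intro a ha
    obtain ⟨i, rfl⟩ := (List.mem_ofFn' _ _).1 ha
    -- An isotropic member of an orthogonal basis would be orthogonal to all of `N`.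
    refine ⟨(v i).2, fun h => v.ne_zero i (Subtype.ext (hN _ (v i).2 fun y hy => ?_))⟩
    rw [hspan] at hy
    induction hy using Submodule.span_induction with
    | mem y hy =>
      obtain ⟨j, rfl⟩ := hy
      rcases eq_or_ne i j with rfl | hij
      · exact h
      · exact hv' i j hij
    | zero => simp
    | add x y _ _ hx hy => rw [map_add, hx, hy, add_zero]
    | smul c x _ hx => rw [map_smul, hx, smul_zero]
  · rw [List.pairwise_ofFn]
    exact fun i j hij => hv' i j hij.ne
  · refine hspan.trans (congrArg _ ?_)
    ext x
    exact (List.mem_ofFn' _ _).symm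

theorem NondegenerateOn.exists_add [FiniteDimensional F V] (hB : ∀ x y, B x y = B y x)
    {U : Submodule F V} (hU : NondegenerateOn B U) (v : V) :
    ∃ u ∈ U, ∃ w, (∀ x ∈ U, B x w = 0) ∧ v = u + w := by
  have h : IsCompl U (B.orthogonal U) := by
    rw [LinearMap.BilinForm.isCompl_orthogonal_iff_disjoint
      (fun x y h => by rw [hB]; exact h), Submodule.disjoint_def]
    exact fun x hx hx' => hU x hx fun y hy => by rw [hB]; exact hx' y hy
  have hv : v ∈ U ⊔ B.orthogonal U := h.sup_eq_top ▸ Submodule.mem_top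
  obtain ⟨u, hu, w, hw, rfl⟩ := Submodule.mem_sup.1 hv
  exact ⟨u, hu, w, fun x hx => hw x hx, rfl⟩

/-- By polarization, a form vanishing on the diagonal vanishes identically on `U`. -/
theorem NondegenerateOn.exists_ne_zero (h2 : (2 : F) ≠ 0) (hB : ∀ x y, B x y = B y x)
    {U : Submodule F V} (hU : NondegenerateOn B U) (h : U ≠ ⊥) : ∃ v ∈ U, B v v ≠ 0 := by
  by_contra! hc
  obtain ⟨x, hx, hx0⟩ := Submodule.exists_mem_ne_zero_of_ne_bot h
  refine hx0 (hU x hx fun y hy => ?_)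
  have h1 := hc _ (add_mem hx hy)
  simp only [map_add, LinearMap.add_apply, hc x hx, hc y hy, hB y x, zero_add, add_zero,
    ← two_mul] at h1
  exact (mul_eq_zero.1 h1).resolve_left h2

/-- An involutive isometry of a nondegenerate subspace is a product of reflections along an
orthogonal basis of its `-1`-eigenspace. -/
theorem exists_reflectProd_eq_of_involution [FiniteDimensional F V] (h2 : (2 : F) ≠ 0)
    (hB : ∀ x y, B x y = B y x) {U : Submodule F V} (hU : NondegenerateOn B U) (h : V →ₗ[F] V)
    (hm : ∀ x ∈ U, h x ∈ U) (hh : ∀ x ∈ U, h (h x) = x)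
    (hi : ∀ x ∈ U, ∀ y ∈ U, B (h x) (h y) = B x y) :
    ∃ l : List V, (∀ a ∈ l, a ∈ U ∧ B a a ≠ 0) ∧ (l.Pairwise fun a b => B a b = 0) ∧
      l.length = Module.finrank F ↥(U ⊓ LinearMap.ker (h + LinearMap.id)) ∧
      ∀ v ∈ U, reflectProd B l v = h v := by
  set N := U ⊓ LinearMap.ker (h + LinearMap.id) with hNdef
  have memN : ∀ x, x ∈ N ↔ x ∈ U ∧ h x = -x := fun x => by
    simp [hNdef, add_eq_zero_iff_eq_neg]
  -- Eigenvectors of an isometry for -1 and 1 are orthogonal: `B x y = -B x y`.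
  have hperp : ∀ x ∈ N, ∀ y ∈ U, h y = y → B x y = 0 := by
    intro x hx y hy hyy
    rw [memN] at hx
    have := hi x hx.1 y hy
    rw [hx.2, hyy, map_neg, LinearMap.neg_apply, neg_eq_iff_add_eq_zero, ← two_mul] at this
    exact (mul_eq_zero.1 this).resolve_left h2
  have hdec : ∀ y ∈ U, ∃ n ∈ N, ∃ p ∈ U, h p = p ∧ y = n + p := by
    intro y hy
    refine ⟨(2 : F)⁻¹ • (y - h y), ?_, (2 : F)⁻¹ • (y + h y),
      U.smul_mem _ (add_mem hy (hm y hy)), ?_, ?_⟩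
    · rw [memN]
      refine ⟨U.smul_mem _ (sub_mem hy (hm y hy)), ?_⟩
      rw [map_smul, map_sub, hh y hy, ← smul_neg, neg_sub]
    · rw [map_smul, map_add, hh y hy, add_comm]
    · rw [← smul_add, sub_add_add_cancel, ← two_smul F, smul_smul, inv_mul_cancel₀ h2, one_smul]
  have hN : NondegenerateOn B N := by
    intro x hx hxx
    refine hU x ((memN x).1 hx).1 fun y hy => ?_
    obtain ⟨n, hn, p, hp, hpp, rfl⟩ := hdec y hy
    rw [map_add, hxx n hn, hperp x hx p hp hpp, add_zero]
  obtain ⟨l, hl, hlp, hlen, hspan⟩ := exists_orthogonal_list h2 hB hN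
  refine ⟨l, fun a ha => ⟨((memN a).1 (hl a ha).1).1, (hl a ha).2⟩, hlp, hlen, fun v hv => ?_⟩
  obtain ⟨n, hn, p, hp, hpp, rfl⟩ := hdec v hv
  have h1 : reflectProd B l p = p :=
    reflectProd_of_ortho fun a ha => hperp a (hl a ha).1 p hp hpp
  have h3 : reflectProd B l n = -n := by
    clear hv
    rw [hspan] at hn
    induction hn using Submodule.span_induction with
    | mem x hx => exact reflectProd_of_mem hB (fun a ha => (hl a ha).2) hlp hx
    | zero => simp
    | add x y _ _ hx hy => rw [map_add, hx, hy, neg_add]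
    | smul c x _ hx => rw [map_smul, hx, smul_neg]
  rw [map_add, map_add, h1, h3, hpp, ((memN n).1 hn).2]

/-- If an involution anticommutes with an injective map, its `-1`-eigenspace has half the
dimension. -/
theorem two_mul_finrank_of_anticommute [FiniteDimensional F V] (h2 : (2 : F) ≠ 0)
    {U : Submodule F V} (h S : V →ₗ[F] V)
    (hm : ∀ x ∈ U, h x ∈ U) (hh : ∀ x ∈ U, h (h x) = x)
    (hS : ∀ x ∈ U, S x ∈ U) (hS0 : ∀ x ∈ U, S x = 0 → x = 0)
    (hSh : ∀ x ∈ U, h (S x) = -S (h x)) :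
    2 * Module.finrank F ↥(U ⊓ LinearMap.ker (h + LinearMap.id)) = Module.finrank F U := by
  set N := U ⊓ LinearMap.ker (h + LinearMap.id) with hNdef
  set P := U ⊓ LinearMap.ker (h - LinearMap.id) with hPdef
  have memN : ∀ x, x ∈ N ↔ x ∈ U ∧ h x = -x := fun x => by
    simp [hNdef, add_eq_zero_iff_eq_neg]
  have memP : ∀ x, x ∈ P ↔ x ∈ U ∧ h x = x := fun x => by
    simp [hPdef, sub_eq_zero]
  have hsup : N ⊔ P = U := by
    refine le_antisymm (sup_le inf_le_left inf_le_left) fun y hy => ?_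
    refine Submodule.mem_sup.2 ⟨(2 : F)⁻¹ • (y - h y), ?_, (2 : F)⁻¹ • (y + h y), ?_, ?_⟩
    · rw [memN]
      refine ⟨U.smul_mem _ (sub_mem hy (hm y hy)), ?_⟩
      rw [map_smul, map_sub, hh y hy, ← smul_neg, neg_sub]
    · rw [memP]
      refine ⟨U.smul_mem _ (add_mem hy (hm y hy)), ?_⟩
      rw [map_smul, map_add, hh y hy, add_comm]
    · rw [← smul_add, sub_add_add_cancel, ← two_smul F, smul_smul, inv_mul_cancel₀ h2, one_smul]
  have hinf : N ⊓ P = ⊥ := by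
    rw [eq_bot_iff]
    rintro x ⟨hx, hx'⟩
    have h1 := ((memN x).1 hx).2
    rw [((memP x).1 hx').2, eq_neg_iff_add_eq_zero, ← two_smul F] at h1
    exact (smul_eq_zero.1 h1).resolve_left h2
  -- By anticommutation, `S` exchanges the two eigenspaces; being injective on both, it forces equal
  -- dimensions.
  have hNP : Module.finrank F N ≤ Module.finrank F P := by
    refine LinearMap.finrank_le_finrank_of_injective (f := S.restrict fun x hx => ?_) ?_
    · have hx := (memN x).1 hx
      rw [memP, hSh x hx.1, hx.2, map_neg, neg_neg]
      exact ⟨hS x hx.1, rfl⟩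
    · rw [injective_iff_map_eq_zero]
      exact fun x hx => Subtype.ext (hS0 x ((memN x).1 x.2).1 (congrArg Subtype.val hx))
  have hPN : Module.finrank F P ≤ Module.finrank F N := by
    refine LinearMap.finrank_le_finrank_of_injective (f := S.restrict fun x hx => ?_) ?_
    · have hx := (memP x).1 hx
      rw [memN, hSh x hx.1, hx.2]
      exact ⟨hS x hx.1, rfl⟩
    · rw [injective_iff_map_eq_zero]
      exact fun x hx => Subtype.ext (hS0 x ((memP x).1 x.2).1 (congrArg Subtype.val hx))
  have := Submodule.finrank_sup_add_finrank_inf_eq N P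
  rw [hsup, hinf, finrank_bot] at this
  lia

/-! ### Cyclic subspaces of an isometry -/

/-- The subspace spanned by the orbit of `v` under the powers of `T`. -/
def orbitSpan (T : V ≃ₗ[F] V) (v : V) : Submodule F V :=
  Submodule.span F (Set.range fun i : ℤ => (T ^ i) v)

theorem pow_mem_orbitSpan (T : V ≃ₗ[F] V) (v : V) (i : ℤ) : (T ^ i) v ∈ orbitSpan T v :=
  Submodule.subset_span ⟨i, rfl⟩

theorem self_mem_orbitSpan (T : V ≃ₗ[F] V) (v : V) : v ∈ orbitSpan T v :=
  pow_mem_orbitSpan T v 0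

theorem map_pow_mem_orbitSpan (T : V ≃ₗ[F] V) (v : V) (j : ℤ) {x : V} (hx : x ∈ orbitSpan T v) :
    (T ^ j) x ∈ orbitSpan T v := by
  induction hx using Submodule.span_induction with
  | mem x hx =>
    obtain ⟨i, rfl⟩ := hx
    rw [← LinearEquiv.mul_apply, ← zpow_add]
    exact pow_mem_orbitSpan T v _
  | zero => simp
  | add x y _ _ hx hy => rw [map_add]; exact add_mem hx hy
  | smul c x _ hx => rw [map_smul]; exact Submodule.smul_mem _ _ hx

theorem inv_mem_of_map_mem [FiniteDimensional F V] {T : V ≃ₗ[F] V} {W : Submodule F V}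
    (hW : ∀ x ∈ W, T x ∈ W) {x : V} (hx : x ∈ W) : T⁻¹ x ∈ W := by
  have h : W.map T.toLinearMap = W := by
    refine Submodule.eq_of_le_of_finrank_eq ?_ (LinearEquiv.finrank_map_eq T W)
    rintro _ ⟨y, hy, rfl⟩
    exact hW y hy
  rw [← h] at hx
  obtain ⟨y, hy, rfl⟩ := hx
  have : T⁻¹ (T y) = y := T.symm_apply_apply y
  exact this.symm ▸ hy

theorem orbitSpan_le [FiniteDimensional F V] {T : V ≃ₗ[F] V} {W : Submodule F V}
    (hW : ∀ x ∈ W, T x ∈ W) {v : V} (hv : v ∈ W) : orbitSpan T v ≤ W := by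
  refine Submodule.span_le.2 ?_
  rintro _ ⟨i, rfl⟩
  have hn : ∀ n : ℕ, (T ^ n) v ∈ W := fun n => by
    induction n with
    | zero => simpa
    | succ n ih => rw [pow_succ']; exact hW _ ih
  have hn' : ∀ n : ℕ, (T⁻¹ ^ n) v ∈ W := fun n => by
    induction n with
    | zero => simpa
    | succ n ih => rw [pow_succ']; exact inv_mem_of_map_mem hW ih
  obtain ⟨n, rfl | rfl⟩ := i.eq_nat_or_neg
  · simpa using hn n
  · simpa using hn' n

theorem isometry_zpow {T : V ≃ₗ[F] V} (hT : ∀ x y, B (T x) (T y) = B x y) (i : ℤ) (x y : V) :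
    B ((T ^ i) x) ((T ^ i) y) = B x y := by
  induction i with
  | zero => simp
  | succ n ih =>
    rw [add_comm, zpow_add, zpow_one, LinearEquiv.mul_apply, LinearEquiv.mul_apply, hT, ih]
  | pred n ih =>
    rw [← ih, ← hT ((T ^ (-(n : ℤ) - 1)) x), ← LinearEquiv.mul_apply T, ← LinearEquiv.mul_apply T]
    have : T * T ^ (-(n : ℤ) - 1) = T ^ (-(n : ℤ)) := by
      rw [← zpow_one_add]; congr 1; ring
    rw [this]

/-- On a nondegenerate cyclic subspace, `Tⁱ v ↦ T⁻ⁱ v` is a well defined isometry. -/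
theorem exists_inverting_map (hB : ∀ x y, B x y = B y x) {T : V ≃ₗ[F] V}
    (hT : ∀ x y, B (T x) (T y) = B x y) {v : V} (hv : NondegenerateOn B (orbitSpan T v)) :
    ∃ h : V →ₗ[F] V, (∀ i : ℤ, h ((T ^ i) v) = (T ^ (-i)) v) ∧
      ∀ x ∈ orbitSpan T v, ∀ y ∈ orbitSpan T v, B (h x) (h y) = B x y := by
  let f := Finsupp.linearCombination F fun i : ℤ => (T ^ i) v
  let f' := Finsupp.linearCombination F fun i : ℤ => (T ^ (-i)) v
  have hf : LinearMap.range f = orbitSpan T v := Finsupp.range_linearCombination F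
  have hf' : LinearMap.range f' = orbitSpan T v := by
    rw [Finsupp.range_linearCombination, orbitSpan,
      ← (Equiv.neg ℤ).surjective.range_comp fun i : ℤ => (T ^ i) v]
    rfl
  -- Applying `T ^ (i + j)` turns the exponents (-i, -j) into (j, i), and the form is symmetric.
  have hgram : ∀ i j : ℤ, B ((T ^ (-i)) v) ((T ^ (-j)) v) = B ((T ^ i) v) ((T ^ j) v) := by
    intro i j
    rw [← isometry_zpow hT (i + j), ← LinearEquiv.mul_apply, ← LinearEquiv.mul_apply, ← zpow_add,
      ← zpow_add, hB]
    congr 3 <;> ring_nf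
  have hff : ∀ x y, B (f' x) (f' y) = B (f x) (f y) := by
    have : B.compl₁₂ f' f' = B.compl₁₂ f f := by
      ext i j
      simpa [f, f'] using hgram i j
    exact fun x y => LinearMap.congr_fun₂ this x y
  -- A relation among the `T ^ i v` gives, by equality of Gram matrices, a vector orthogonal to the
  -- whole orbit span, hence zero. This is well-definedness.
  have hker : ∀ x, f x = 0 → f' x = 0 := by
    intro x hx
    refine hv _ (hf' ▸ ⟨x, rfl⟩) fun y hy => ?_
    rw [← hf'] at hy
    obtain ⟨y, rfl⟩ := hy
    rw [hff, hx, map_zero, LinearMap.zero_apply]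
  obtain ⟨s, hs⟩ := f.rangeRestrict.exists_rightInverse_of_surjective f.range_rangeRestrict
  obtain ⟨h, hh⟩ := (f' ∘ₗ s).exists_extend
  have key : ∀ x, h (f x) = f' x := by
    intro x
    have h1 : h (f x) = f' (s (f.rangeRestrict x)) := LinearMap.congr_fun hh (f.rangeRestrict x)
    have h3 : f (s (f.rangeRestrict x)) = f x :=
      congrArg Subtype.val (LinearMap.congr_fun hs (f.rangeRestrict x))
    rw [h1, ← sub_eq_zero, ← map_sub]
    exact hker _ (by rw [map_sub, h3, sub_self])
  refine ⟨h, fun i => ?_, ?_⟩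
  · simpa [f, f'] using key (Finsupp.single i 1)
  · rw [← hf]
    rintro _ ⟨x, rfl⟩ _ ⟨y, rfl⟩
    rw [key, key, hff]

end LinearAlgebra

/-! ### Factoring a semisimple isometry into two involutions -/

section Factorization

variable {B : LinearMap.BilinForm F V}

/-- An invariant complement in V is cut down to `W` by the modular law. -/
theorem exists_invariant_compl {T : V ≃ₗ[F] V}
    (hss : Module.End.IsSemisimple (T : V →ₗ[F] V)) {A W : Submodule F V}
    (hA : ∀ x ∈ A, T x ∈ A) (hW : ∀ x ∈ W, T x ∈ W) (hAW : A ≤ W) :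
    ∃ A' ≤ W, (∀ x ∈ A', T x ∈ A') ∧ (∀ x ∈ A, x ∈ A' → x = 0) ∧ A ⊔ A' = W := by
  obtain ⟨q, hq, hc⟩ := Module.End.isSemisimple_iff.1 hss A hA
  refine ⟨W ⊓ q, inf_le_left, fun x hx => ⟨hW x hx.1, hq hx.2⟩,
    fun x hx hx' => (Submodule.disjoint_def.1 hc.disjoint) x hx hx'.2, ?_⟩
  rw [inf_comm, ← sup_inf_assoc_of_le _ hAW, hc.sup_eq_top, top_inf_eq]

/-- If all eigenvectors for `ε = ±1` in a nondegenerate invariant subspace are isotropic, then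
there are none. -/
theorem eq_zero_of_isotropic_eigenvectors [FiniteDimensional F V] (h2 : (2 : F) ≠ 0)
    (hB : ∀ x y, B x y = B y x)
    {T : V ≃ₗ[F] V} (hT : ∀ x y, B (T x) (T y) = B x y)
    (hss : Module.End.IsSemisimple (T : V →ₗ[F] V)) {W : Submodule F V}
    (hW : ∀ x ∈ W, T x ∈ W) (hWn : NondegenerateOn B W) {ε : F} (hε : ε * ε = 1)
    (hiso : ∀ x ∈ W, T x = ε • x → B x x = 0) {x : V} (hx : x ∈ W) (hxT : T x = ε • x) :
    x = 0 := by
  set A := W ⊓ LinearMap.ker ((T : V →ₗ[F] V) - ε • LinearMap.id) with hA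
  have memA : ∀ y, y ∈ A ↔ y ∈ W ∧ T y = ε • y := fun y => by simp [hA, sub_eq_zero]
  have hAT : ∀ y ∈ A, T y ∈ A := fun y hy => by
    rw [memA] at hy ⊢
    exact ⟨hW y hy.1, by rw [hy.2, map_smul, hy.2]⟩
  obtain ⟨A', hA'W, hA'T, hdisj, hsup⟩ := exists_invariant_compl hss hAT hW inf_le_left
  -- Polarization: the eigenspace is totally isotropic.
  have hAA : ∀ y ∈ A, ∀ z ∈ A, B y z = 0 := by
    intro y hy z hz
    have hyz := add_mem hy hz
    rw [memA] at hy hz hyz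
    have h1 := hiso _ hyz.1 hyz.2
    simp only [map_add, LinearMap.add_apply, hiso _ hy.1 hy.2, hiso _ hz.1 hz.2, hB z y, zero_add,
      add_zero, ← two_mul] at h1
    exact (mul_eq_zero.1 h1).resolve_left h2
  -- `T - ε` is bijective on `A'`, and its image is orthogonal to the ε-eigenspace because `ε⁻¹ =
  -- ε`. So `A` lies in the radical of `W`.
  have hAA' : ∀ y ∈ A, ∀ z ∈ A', B y z = 0 := by
    intro y hy z hz
    let f : A' →ₗ[F] A' := ((T : V →ₗ[F] V) - ε • LinearMap.id).restrict
      fun u hu => sub_mem (hA'T u hu) (A'.smul_mem _ hu)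
    have hf : Function.Injective f := by
      rw [injective_iff_map_eq_zero]
      rintro ⟨u, hu⟩ h
      have h' : T u - ε • u = 0 := congrArg Subtype.val h
      exact Subtype.ext (hdisj u ((memA u).2 ⟨hA'W hu, sub_eq_zero.1 h'⟩) hu)
    obtain ⟨⟨u, hu⟩, h⟩ := LinearMap.injective_iff_surjective.1 hf ⟨z, hz⟩
    have h' : T u - ε • u = z := congrArg Subtype.val h
    have h3 : B y (T u) = ε * B y u := by
      have h4 := hT y u
      rw [((memA y).1 hy).2, map_smul, LinearMap.smul_apply, smul_eq_mul] at h4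
      rw [← h4, ← mul_assoc, hε, one_mul]
    rw [← h', map_sub, map_smul, h3, smul_eq_mul, sub_self]
  have hxA : x ∈ A := (memA x).2 ⟨hx, hxT⟩
  refine hWn x hx fun y hy => ?_
  rw [← hsup] at hy
  obtain ⟨a, ha, a', ha', rfl⟩ := Submodule.mem_sup.1 hy
  rw [map_add, hAA x hxA a ha, hAA' x hxA a' ha', add_zero]

/-- An anisotropic vector whose orbit spans a subspace of minimal dimension spans a nondegenerate
subspace. -/
theorem exists_nondegenerateOn_orbitSpan [FiniteDimensional F V] (h2 : (2 : F) ≠ 0)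
    (hB : ∀ x y, B x y = B y x) {T : V ≃ₗ[F] V} (hT : ∀ x y, B (T x) (T y) = B x y)
    (hss : Module.End.IsSemisimple (T : V →ₗ[F] V)) {W : Submodule F V}
    (hWn : NondegenerateOn B W) (hW0 : W ≠ ⊥) (hW : ∀ x ∈ W, T x ∈ W) :
    ∃ v ∈ W, B v v ≠ 0 ∧ NondegenerateOn B (orbitSpan T v) := by
  obtain ⟨v₀, hv₀, hv₀'⟩ := hWn.exists_ne_zero h2 hB hW0
  obtain ⟨v, ⟨hv, hv'⟩, hmin⟩ := WellFounded.has_min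
    (measure fun v => Module.finrank F (orbitSpan T v)).wf {v | v ∈ W ∧ B v v ≠ 0}
    ⟨v₀, hv₀, hv₀'⟩
  refine ⟨v, hv, hv', ?_⟩
  set U := orbitSpan T v with hU
  have hUT : ∀ x ∈ U, T x ∈ U := fun x hx => by simpa using map_pow_mem_orbitSpan T v 1 hx
  have hUinv : ∀ x ∈ U, T⁻¹ x ∈ U := fun x hx => inv_mem_of_map_mem hUT hx
  have hUW : U ≤ W := orbitSpan_le hW hv
  -- If the radical `R` were nonzero, the component `r'` of `v` in an invariant complement would
  -- still be anisotropic, with a smaller orbit span.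
  set R := U ⊓ B.orthogonal U with hR
  have hRT : ∀ x ∈ R, T x ∈ R := by
    refine fun x hx => ⟨hUT x hx.1, fun y hy => ?_⟩
    have : T (T⁻¹ y) = y := T.apply_symm_apply y
    change B y (T x) = 0
    rw [← this, hT]
    exact hx.2 _ (hUinv y hy)
  obtain ⟨R', hR'U, hR'T, hdisj, hsup⟩ := exists_invariant_compl hss hRT hUT inf_le_left
  have hvU : v ∈ R ⊔ R' := hsup.symm ▸ hU ▸ self_mem_orbitSpan T v
  obtain ⟨r, hr, r', hr', hrr⟩ := Submodule.mem_sup.1 hvU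
  have hr'v : B r' r' ≠ 0 := by
    have h1 : B r' r = 0 := hr.2 r' (hR'U hr')
    have h3 : B r r = 0 := hr.2 r hr.1
    rw [← hrr] at hv'
    simpa [h1, h3, hB r r'] using hv'
  intro z hz hzU
  by_contra hz0
  have hzR : z ∈ R := ⟨hz, fun y hy => (hB y z).trans (hzU y hy)⟩
  have hlt : R' < U := by
    refine lt_of_le_of_ne hR'U fun h => hz0 (hdisj z hzR (h ▸ hz))
  exact hmin r' ⟨hUW (hR'U hr'), hr'v⟩
    ((Submodule.finrank_mono (orbitSpan_le hR'T hr')).trans_lt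
      (Submodule.finrank_lt_finrank_of_lt hlt))

/-- On `W`, the map `T` is a product of two involutions which are products of reflections along
pairwise orthogonal vectors of `W`; the numbers `r` and `p` measure the freedom in choosing the
numbers of these vectors. -/
def HasInvolutionFactors (B : LinearMap.BilinForm F V) (T : V ≃ₗ[F] V) (W : Submodule F V)
    (m r p : ℕ) : Prop :=
  ∀ s ≤ r, ∀ j ≤ p, ∃ a b : List V,
    (∀ x ∈ a, x ∈ W ∧ B x x ≠ 0) ∧ (∀ x ∈ b, x ∈ W ∧ B x x ≠ 0) ∧
    (a.Pairwise fun x y => B x y = 0) ∧ (b.Pairwise fun x y => B x y = 0) ∧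
    a.length = m + s + j ∧ b.length = m + (r - s) + j ∧
    ∀ v ∈ W, reflectProd B a (reflectProd B b v) = T v

theorem hasInvolutionFactors_bot (T : V ≃ₗ[F] V) : HasInvolutionFactors B T ⊥ 0 0 0 := by
  intro s hs j hj
  obtain rfl : s = 0 := by lia
  obtain rfl : j = 0 := by lia
  refine ⟨[], [], by simp, by simp, by simp, by simp, by simp, by simp, fun v hv => ?_⟩
  rw [(Submodule.mem_bot F).1 hv]; simp

theorem reflectProd_singleton_of_mem_span {v x : V} (hv : B v v ≠ 0)
    (hx : x ∈ Submodule.span F {v}) : reflectProd B [v] x = -x := by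
  obtain ⟨c, rfl⟩ := Submodule.mem_span_singleton.1 hx
  rw [map_smul, reflectProd_cons, reflectProd_nil, reflect_self hv, smul_neg]

/-- The identity of a line is both 1·1 and (-1)(-1), so both factors gain a vector or neither does.
-/
theorem hasInvolutionFactors_of_fixed {T : V ≃ₗ[F] V} {v : V} (hv : B v v ≠ 0) (hTv : T v = v) :
    HasInvolutionFactors B T (Submodule.span F {v}) 0 0 1 := by
  have hv' : v ∈ Submodule.span F {v} ∧ B v v ≠ 0 := ⟨Submodule.mem_span_singleton_self v, hv⟩
  have hT : ∀ x ∈ Submodule.span F {v}, T x = x := fun x hx => by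
    obtain ⟨c, rfl⟩ := Submodule.mem_span_singleton.1 hx
    rw [map_smul, hTv]
  intro s hs j hj
  obtain rfl : s = 0 := by lia
  obtain rfl | rfl : j = 0 ∨ j = 1 := by lia
  · exact ⟨[], [], by simp, by simp, by simp, by simp, by simp, by simp,
      fun x hx => by simp [hT x hx]⟩
  · refine ⟨[v], [v], by simpa using hv', by simpa using hv', by simp, by simp, by simp, by simp,
      fun x hx => ?_⟩
    rw [reflectProd_singleton_of_mem_span hv hx, map_neg,
      reflectProd_singleton_of_mem_span hv hx, neg_neg, hT x hx]

/-- Exactly one of the two factors is -1 on the line, and either may be. -/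
theorem hasInvolutionFactors_of_neg {T : V ≃ₗ[F] V} {v : V} (hv : B v v ≠ 0) (hTv : T v = -v) :
    HasInvolutionFactors B T (Submodule.span F {v}) 0 1 0 := by
  have hT : ∀ x ∈ Submodule.span F {v}, T x = -x := fun x hx => by
    obtain ⟨c, rfl⟩ := Submodule.mem_span_singleton.1 hx
    rw [map_smul, hTv, smul_neg]
  have hv' : v ∈ Submodule.span F {v} ∧ B v v ≠ 0 := ⟨Submodule.mem_span_singleton_self v, hv⟩
  intro s hs j hj
  obtain rfl : j = 0 := by lia
  obtain rfl | rfl : s = 0 ∨ s = 1 := by lia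
  · refine ⟨[], [v], by simp, by simpa using hv', by simp, by simp, by simp, by simp,
      fun x hx => ?_⟩
    rw [reflectProd_nil, reflectProd_singleton_of_mem_span hv hx, hT x hx]
  · refine ⟨[v], [], by simpa using hv', by simp, by simp, by simp, by simp, by simp,
      fun x hx => ?_⟩
    rw [reflectProd_nil, reflectProd_singleton_of_mem_span hv hx, hT x hx]

/-- Both `h` and `h T` are isometric involutions, because `h` inverts `T`. Both anticommute with `S
= T - T⁻¹`, which is injective as `T²` has no nonzero fixed vector; so each (-1)-eigenspace is half
of the space. -/
theorem exists_hasInvolutionFactors_orbitSpan [FiniteDimensional F V] (h2 : (2 : F) ≠ 0)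
    (hB : ∀ x y, B x y = B y x) {T : V ≃ₗ[F] V} (hT : ∀ x y, B (T x) (T y) = B x y) {v : V}
    (hv : NondegenerateOn B (orbitSpan T v))
    (hT2 : ∀ x ∈ orbitSpan T v, T (T x) = x → x = 0) :
    ∃ m, 2 * m = Module.finrank F (orbitSpan T v) ∧
      HasInvolutionFactors B T (orbitSpan T v) m 0 0 := by
  obtain ⟨h, hh, hiso⟩ := exists_inverting_map hB hT hv
  set U := orbitSpan T v with hU
  have hUT : ∀ x ∈ U, T x ∈ U := fun x hx => by simpa using map_pow_mem_orbitSpan T v 1 hx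
  have hUinv : ∀ x ∈ U, T⁻¹ x ∈ U := fun x hx => inv_mem_of_map_mem hUT hx
  have hTi : ∀ x, T (T⁻¹ x) = x := T.apply_symm_apply
  have hiT : ∀ x, T⁻¹ (T x) = x := T.symm_apply_apply
  have hm : ∀ x ∈ U, h x ∈ U := by
    intro x hx
    induction hx using Submodule.span_induction with
    | mem x hx => obtain ⟨i, rfl⟩ := hx; rw [hh]; exact pow_mem_orbitSpan T v _
    | zero => simp
    | add x y _ _ hx hy => rw [map_add]; exact add_mem hx hy
    | smul c x _ hx => rw [map_smul]; exact Submodule.smul_mem _ _ hx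
  have hinv : ∀ x ∈ U, h (h x) = x := by
    intro x hx
    induction hx using Submodule.span_induction with
    | mem x hx => obtain ⟨i, rfl⟩ := hx; rw [hh, hh, neg_neg]
    | zero => simp
    | add x y _ _ hx hy => rw [map_add, map_add, hx, hy]
    | smul c x _ hx => rw [map_smul, map_smul, hx]
  have hcomm : ∀ x ∈ U, h (T x) = T⁻¹ (h x) := by
    intro x hx
    induction hx using Submodule.span_induction with
    | mem x hx =>
      obtain ⟨i, rfl⟩ := hx
      rw [hh, ← LinearEquiv.mul_apply, ← LinearEquiv.mul_apply, ← zpow_one_add, hh,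
        ← zpow_neg_one, ← zpow_add]
      congr 2; ring
    | zero => simp
    | add x y _ _ hx hy => rw [map_add, map_add, map_add, map_add, hx, hy]
    | smul c x _ hx => rw [map_smul, map_smul, map_smul, map_smul, hx]
  have hcomm' : ∀ x ∈ U, h (T⁻¹ x) = T (h x) := fun x hx => by
    rw [← hTi (h (T⁻¹ x)), ← hcomm _ (hUinv x hx), hTi]
  set S : V →ₗ[F] V := (T : V →ₗ[F] V) - (T⁻¹ : V ≃ₗ[F] V) with hS
  have hSx : ∀ x, S x = T x - T⁻¹ x := fun x => rfl
  have hSU : ∀ x ∈ U, S x ∈ U := fun x hx => sub_mem (hUT x hx) (hUinv x hx)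
  have hS0 : ∀ x ∈ U, S x = 0 → x = 0 := fun x hx h0 => hT2 x hx <| by
    rw [hSx, sub_eq_zero] at h0
    rw [h0, hTi]
  have hSh : ∀ x ∈ U, h (S x) = -S (h x) := fun x hx => by
    rw [hSx, map_sub, hcomm x hx, hcomm' x hx, hSx, neg_sub]
  let h' : V →ₗ[F] V := h ∘ₗ (T : V →ₗ[F] V)
  have hx' : ∀ x, h' x = h (T x) := fun x => rfl
  have hm' : ∀ x ∈ U, h' x ∈ U := fun x hx => hm _ (hUT x hx)
  have hinv' : ∀ x ∈ U, h' (h' x) = x := fun x hx => by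
    rw [hx', hx', hcomm x hx, hTi, hinv x hx]
  have hSh' : ∀ x ∈ U, h' (S x) = -S (h' x) := fun x hx => by
    have : T (S x) = S (T x) := by rw [hSx, hSx, map_sub, hTi, hiT]
    rw [hx', hx', this, hSh _ (hUT x hx)]
  have hiso' : ∀ x ∈ U, ∀ y ∈ U, B (h' x) (h' y) = B x y := fun x hx y hy => by
    rw [hx', hx', hiso _ (hUT x hx) _ (hUT y hy), hT]
  obtain ⟨a, ha, hap, hal, haR⟩ := exists_reflectProd_eq_of_involution h2 hB hv h hm hinv hiso
  obtain ⟨b, hb, hbp, hbl, hbR⟩ := exists_reflectProd_eq_of_involution h2 hB hv h' hm' hinv' hiso'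
  have d1 := two_mul_finrank_of_anticommute h2 h S hm hinv hSU hS0 hSh
  have d2 := two_mul_finrank_of_anticommute h2 h' S hm' hinv' hSU hS0 hSh'
  refine ⟨_, d1, fun s hs j hj => ⟨a, b, ha, hb, hap, hbp, by lia, by lia, fun x hx => ?_⟩⟩
  rw [hbR x hx, haR _ (hm' x hx), hx', hinv _ (hUT x hx)]

theorem HasInvolutionFactors.add [FiniteDimensional F V] (hB : ∀ x y, B x y = B y x)
    {T : V ≃ₗ[F] V} {U U' W : Submodule F V} {m r p m' r' p' : ℕ}
    (h : HasInvolutionFactors B T U m r p) (h' : HasInvolutionFactors B T U' m' r' p')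
    (hU : U ≤ W) (hU' : U' ≤ W) (hUU' : ∀ x ∈ U, ∀ y ∈ U', B x y = 0)
    (hW : ∀ w ∈ W, ∃ x ∈ U, ∃ y ∈ U', w = x + y) :
    HasInvolutionFactors B T W (m + m') (r + r') (p + p') := by
  intro s hs j hj
  -- The parameters `s` and `j` are spent on `U` as far as possible; the remainder goes to `U'`.
  obtain ⟨a, b, ha, hb, hap, hbp, hal, hbl, hab⟩ := h (min s r) (by lia) (min j p) (by lia)
  obtain ⟨a', b', ha', hb', hap', hbp', hal', hbl', hab'⟩ :=
    h' (s - min s r) (by lia) (j - min j p) (by lia)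
  refine ⟨a ++ a', b ++ b', ?_, ?_, ?_, ?_, ?_, ?_, ?_⟩
  · intro x hx
    rcases List.mem_append.1 hx with hx | hx
    · exact ⟨hU (ha x hx).1, (ha x hx).2⟩
    · exact ⟨hU' (ha' x hx).1, (ha' x hx).2⟩
  · intro x hx
    rcases List.mem_append.1 hx with hx | hx
    · exact ⟨hU (hb x hx).1, (hb x hx).2⟩
    · exact ⟨hU' (hb' x hx).1, (hb' x hx).2⟩
  · exact List.pairwise_append.2 ⟨hap, hap', fun x hx y hy => hUU' x (ha x hx).1 y (ha' y hy).1⟩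
  · exact List.pairwise_append.2 ⟨hbp, hbp', fun x hx y hy => hUU' x (hb x hx).1 y (hb' y hy).1⟩
  · rw [List.length_append, hal, hal']; lia
  · rw [List.length_append, hbl, hbl']; lia
  · intro w hw
    obtain ⟨x, hx, y, hy, rfl⟩ := hW w hw
    have e1 : reflectProd B b' x = x :=
      reflectProd_of_ortho fun c hc => by rw [hB]; exact hUU' x hx c (hb' c hc).1
    have hbx : reflectProd B b x ∈ U := reflectProd_mem (fun c hc => (hb c hc).1) hx
    have e2 : reflectProd B a' (reflectProd B b x) = reflectProd B b x :=
      reflectProd_of_ortho fun c hc => by rw [hB]; exact hUU' _ hbx c (ha' c hc).1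
    have hby : reflectProd B b' y ∈ U' := reflectProd_mem (fun c hc => (hb' c hc).1) hy
    have e3 : reflectProd B b (reflectProd B b' y) = reflectProd B b' y :=
      reflectProd_of_ortho fun c hc => hUU' c (hb c hc).1 _ hby
    have hay : reflectProd B a' (reflectProd B b' y) ∈ U' :=
      reflectProd_mem (fun c hc => (ha' c hc).1) hby
    have e4 : reflectProd B a (reflectProd B a' (reflectProd B b' y)) =
        reflectProd B a' (reflectProd B b' y) :=
      reflectProd_of_ortho fun c hc => hUU' c (ha c hc).1 _ hay
    rw [reflectProd_append, reflectProd_append]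
    simp only [map_add]
    rw [e1, e2, e3, e4, hab x hx, hab' y hy]

theorem mem_span_singleton_of_smul {T : V ≃ₗ[F] V} {v : V} {ε : F} (h : T v = ε • v) :
    ∀ x ∈ Submodule.span F {v}, T x ∈ Submodule.span F {v} := fun x hx => by
  obtain ⟨c, rfl⟩ := Submodule.mem_span_singleton.1 hx
  rw [map_smul, h]
  exact Submodule.smul_mem _ _ (Submodule.smul_mem _ _ (Submodule.mem_span_singleton_self v))

theorem nondegenerateOn_span_singleton {v : V} (hv : B v v ≠ 0) :
    NondegenerateOn B (Submodule.span F {v}) := fun x hx h => by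
  obtain ⟨c, rfl⟩ := Submodule.mem_span_singleton.1 hx
  have := h v (Submodule.mem_span_singleton_self v)
  rw [map_smul, LinearMap.smul_apply, smul_eq_mul] at this
  rw [(mul_eq_zero.1 this).resolve_right hv, zero_smul]

/-- An anisotropic eigenvector for 1 or -1 splits off a line. If there is none, neither eigenvalue
occurs, and a minimal cyclic subspace splits off. -/
theorem exists_summand_hasInvolutionFactors [FiniteDimensional F V] (h2 : (2 : F) ≠ 0)
    (hB : ∀ x y, B x y = B y x) {T : V ≃ₗ[F] V} (hT : ∀ x y, B (T x) (T y) = B x y)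
    (hss : Module.End.IsSemisimple (T : V →ₗ[F] V)) {W : Submodule F V}
    (hWn : NondegenerateOn B W) (hW0 : W ≠ ⊥) (hW : ∀ x ∈ W, T x ∈ W) :
    ∃ U ≤ W, U ≠ ⊥ ∧ (∀ x ∈ U, T x ∈ U) ∧ NondegenerateOn B U ∧ ∃ m r p,
      2 * m + r + p = Module.finrank F U ∧ HasInvolutionFactors B T U m r p := by
  have line : ∀ v ∈ W, B v v ≠ 0 → ∀ ε : F, T v = ε • v → ∀ r p, r + p = 1 →
      HasInvolutionFactors B T (Submodule.span F {v}) 0 r p →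
      ∃ U ≤ W, U ≠ ⊥ ∧ (∀ x ∈ U, T x ∈ U) ∧ NondegenerateOn B U ∧ ∃ m r p,
        2 * m + r + p = Module.finrank F U ∧ HasInvolutionFactors B T U m r p := by
    intro v hv hv' ε hε r p hrp hf
    have hv0 : v ≠ 0 := fun h => hv' (by rw [h]; simp)
    refine ⟨Submodule.span F {v}, (Submodule.span_singleton_le_iff_mem v W).2 hv,
      by simpa using hv0, mem_span_singleton_of_smul hε, nondegenerateOn_span_singleton hv', 0, r, p,
      ?_, hf⟩
    rw [finrank_span_singleton hv0]; lia
  by_cases h1 : ∃ v ∈ W, T v = (1 : F) • v ∧ B v v ≠ 0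
  · obtain ⟨v, hv, hTv, hv'⟩ := h1
    exact line v hv hv' 1 hTv 0 1 rfl (hasInvolutionFactors_of_fixed hv' (by simpa using hTv))
  by_cases h3 : ∃ v ∈ W, T v = (-1 : F) • v ∧ B v v ≠ 0
  · obtain ⟨v, hv, hTv, hv'⟩ := h3
    exact line v hv hv' (-1) hTv 1 0 rfl (hasInvolutionFactors_of_neg hv' (by simpa using hTv))
  push Not at h1 h3
  obtain ⟨v, hv, hv', hvn⟩ := exists_nondegenerateOn_orbitSpan h2 hB hT hss hWn hW0 hW
  have hUW := orbitSpan_le hW hv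
  -- If `T² x = x`, then `x + T x` and `x - T x` are eigenvectors for 1 and -1, so both vanish.
  have hT2 : ∀ x ∈ W, T (T x) = x → x = 0 := by
    intro x hx hxx
    have e1 := eq_zero_of_isotropic_eigenvectors h2 hB hT hss hW hWn (ε := 1) (by ring) h1
      (add_mem hx (hW x hx)) (by rw [map_add, hxx, one_smul, add_comm])
    have e2 := eq_zero_of_isotropic_eigenvectors h2 hB hT hss hW hWn (ε := -1) (by ring) h3
      (sub_mem hx (hW x hx)) (by rw [map_sub, hxx, neg_smul, one_smul, neg_sub])
    have e3 : (2 : F) • x = 0 := by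
      rw [two_smul, ← sub_add_add_cancel x x (T x), e1, e2, add_zero]
    exact (smul_eq_zero.1 e3).resolve_left h2
  obtain ⟨m, hm, hf⟩ := exists_hasInvolutionFactors_orbitSpan h2 hB hT hvn
    fun x hx => hT2 x (hUW hx)
  refine ⟨orbitSpan T v, hUW, fun h => ?_, fun x hx => by simpa using map_pow_mem_orbitSpan T v 1 hx,
    hvn, m, 0, 0, by lia, hf⟩
  have := self_mem_orbitSpan T v
  rw [h, Submodule.mem_bot] at this
  rw [this] at hv'
  simp at hv'

/-- Induction on dimension: the orthogonal complement of a nondegenerate invariant summand is again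
invariant and nondegenerate. -/
theorem exists_hasInvolutionFactors [FiniteDimensional F V] (h2 : (2 : F) ≠ 0)
    (hB : ∀ x y, B x y = B y x) {T : V ≃ₗ[F] V} (hT : ∀ x y, B (T x) (T y) = B x y)
    (hss : Module.End.IsSemisimple (T : V →ₗ[F] V)) (W : Submodule F V)
    (hWn : NondegenerateOn B W) (hW : ∀ x ∈ W, T x ∈ W) :
    ∃ m r p, 2 * m + r + p = Module.finrank F W ∧ HasInvolutionFactors B T W m r p := by
  induction hn : Module.finrank F W using Nat.strong_induction_on generalizing W with
  | _ n ih =>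
  subst hn
  by_cases hW0 : W = ⊥
  · subst hW0
    exact ⟨0, 0, 0, by simp, hasInvolutionFactors_bot T⟩
  obtain ⟨U, hUW, hU0, hUT, hUn, m, r, p, hd, hf⟩ :=
    exists_summand_hasInvolutionFactors h2 hB hT hss hWn hW0 hW
  set U' := W ⊓ B.orthogonal U with hU'
  have hdec : ∀ w ∈ W, ∃ x ∈ U, ∃ y ∈ U', w = x + y := by
    intro w hw
    obtain ⟨u, hu, y, hy, rfl⟩ := hUn.exists_add hB w
    exact ⟨u, hu, y, ⟨by simpa using sub_mem hw (hUW hu), hy⟩, rfl⟩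
  have hUU' : ∀ x ∈ U, ∀ y ∈ U', B x y = 0 := fun x hx y hy => hy.2 x hx
  have hsup : U ⊔ U' = W := by
    refine le_antisymm (sup_le hUW inf_le_left) fun w hw => ?_
    obtain ⟨x, hx, y, hy, rfl⟩ := hdec w hw
    exact Submodule.mem_sup.2 ⟨x, hx, y, hy, rfl⟩
  have hinf : U ⊓ U' = ⊥ := by
    rw [eq_bot_iff]
    exact fun x hx => hUn x hx.1 fun y hy => by rw [hB]; exact hUU' y hy x hx.2
  have hrank := Submodule.finrank_sup_add_finrank_inf_eq U U'
  rw [hsup, hinf, finrank_bot, add_zero] at hrank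
  have hpos : 0 < Module.finrank F U := by
    rw [Nat.pos_iff_ne_zero]
    exact fun h => hU0 (Submodule.finrank_eq_zero.1 h)
  obtain ⟨m', r', p', hd', hf'⟩ := ih (Module.finrank F U') (by lia) U' (by
    intro x hx hxx
    refine hWn x hx.1 fun w hw => ?_
    obtain ⟨u, hu, y, hy, rfl⟩ := hdec w hw
    rw [map_add, hxx y hy, add_zero, hB, hUU' u hu x hx]) (by
    refine fun x hx => ⟨hW x hx.1, fun u hu => ?_⟩
    have : T (T⁻¹ u) = u := T.apply_symm_apply u
    change B u (T x) = 0
    rw [← this, hT]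
    exact hx.2 _ (inv_mem_of_map_mem hUT hu)) rfl
  exact ⟨m + m', r + r', p + p', by lia, hf.add hB hf' hUW inf_le_left hUU' hdec⟩

end Factorization

/-! ### From isometries back to the Clifford group -/

section CliffordGroup

variable {Q : QuadraticForm F V} {B : LinearMap.BilinForm F V}

theorem finiteDimensional_cliffordAlgebra [FiniteDimensional F V] (h2 : (2 : F) ≠ 0)
    (Q : QuadraticForm F V) : FiniteDimensional F (CliffordAlgebra Q) := by
  have : Invertible (2 : F) := invertibleOfNonzero h2
  have : FiniteDimensional F (ExteriorAlgebra F V) :=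
    Module.Finite.of_basis (Module.finBasis F V).ExteriorAlgebra
  exact Module.Finite.equiv (equivExterior Q).symm

theorem nontrivial_cliffordAlgebra (h2 : (2 : F) ≠ 0) (Q : QuadraticForm F V) :
    Nontrivial (CliffordAlgebra Q) := by
  have : Invertible (2 : F) := invertibleOfNonzero h2
  infer_instance

/-- An element `x` with `α(x) v = v x` for all vectors `v` is a scalar. -/
theorem exists_eq_algebraMap_of_twisted_commute [FiniteDimensional F V] (h2 : (2 : F) ≠ 0)
    (hB : ∀ x y, B x y = B y x) (hBQ : ∀ v, B v v = Q v) (hn : NondegenerateOn B ⊤)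
    {x : CliffordAlgebra Q} (h : ∀ v, involute x * ι Q v = ι Q v * x) :
    ∃ c : F, x = algebraMap F _ c := by
  obtain ⟨l, hl, hlp, -, hspan⟩ := exists_orthogonal_list h2 hB hn
  refine mem_bot_of_twisted_commute_list h2 hB hBQ l (fun a ha => (hl a ha).2) hlp ?_
    fun a _ => h a
  have : Algebra.adjoin F (Set.range (ι Q)) ≤ listAlgebra Q l := by
    refine Algebra.adjoin_le ?_
    rintro _ ⟨v, rfl⟩
    have hv : v ∈ Submodule.span F {a | a ∈ l} := hspan ▸ Submodule.mem_top
    induction hv using Submodule.span_induction with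
    | mem a ha => exact Algebra.subset_adjoin ⟨a, ha, rfl⟩
    | zero => rw [map_zero]; exact zero_mem _
    | add x y _ _ hx hy => rw [map_add]; exact add_mem hx hy
    | smul c x _ hx => rw [map_smul]; exact Subalgebra.smul_mem _ hx c
  rw [adjoin_range_ι] at this
  exact this Algebra.mem_top

theorem prod_map_ne_zero {l : List V} (hl : ∀ a ∈ l, Q a ≠ 0) : (l.map Q).prod ≠ 0 := by
  rw [Ne, List.prod_eq_zero_iff]
  intro h
  obtain ⟨a, ha, h0⟩ := List.mem_map.1 h
  exact hl a ha h0

/-- `reverse (vecProd Q l)` inverts `vecProd Q l` up to a nonzero scalar, and its product with `u`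
induces the identity on vectors, hence lies in the twisted centre. -/
theorem exists_eq_smul_vecProd [FiniteDimensional F V] (h2 : (2 : F) ≠ 0)
    (hB : ∀ x y, B x y = B y x) (hBQ : ∀ v, B v v = Q v) (hn : NondegenerateOn B ⊤)
    {l : List V} (hl : ∀ a ∈ l, B a a ≠ 0) {u : CliffordAlgebra Q}
    (h : ∀ v, involute u * ι Q v = ι Q (reflectProd B l v) * u) :
    ∃ c : F, u = c • vecProd Q l := by
  have key : ∀ v, involute (reverse (vecProd Q l)) * ι Q (reflectProd B l v) =
      ι Q v * reverse (vecProd Q l) := by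
    intro v
    have h1 := congrArg (fun y => involute (reverse y)) (involute_vecProd_mul_ι hB hBQ l hl v)
    simpa [reverse.map_mul, reverse_involute] using h1.symm
  obtain ⟨c, hc⟩ := exists_eq_algebraMap_of_twisted_commute h2 hB hBQ hn
    (x := reverse (vecProd Q l) * u) fun v => by
      rw [map_mul, mul_assoc, h, ← mul_assoc, key, mul_assoc]
  have h0 : (l.map Q).prod ≠ 0 := prod_map_ne_zero fun a ha => by rw [← hBQ]; exact hl a ha
  refine ⟨(l.map Q).prod⁻¹ * c, ?_⟩
  have h3 := congrArg (vecProd Q l * ·) hc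
  simp only [← mul_assoc, vecProd_mul_reverse_self] at h3
  rw [← Algebra.commutes, ← Algebra.smul_def, ← Algebra.smul_def] at h3
  rw [mul_smul, ← h3, smul_smul, inv_mul_cancel₀ h0, one_smul]

theorem ι_injective_of_nondegenerateOn (h2 : (2 : F) ≠ 0) (hB : ∀ x y, B x y = B y x)
    (hBQ : ∀ v, B v v = Q v) (hn : NondegenerateOn B ⊤) : Function.Injective (ι Q) := by
  have := nontrivial_cliffordAlgebra h2 Q
  rw [injective_iff_map_eq_zero]
  intro a ha
  refine hn a trivial fun b _ => ?_
  have h := ι_mul_ι_eq hB hBQ a b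
  rw [ha, zero_mul, mul_zero, sub_zero, eq_comm, map_eq_zero] at h
  exact (mul_eq_zero.1 h).resolve_left h2

/-- The isometry of `V` induced by an element of `GSpin(V)`. -/
theorem exists_isometry_of_mem_GSpin [FiniteDimensional F V] (h2 : (2 : F) ≠ 0)
    (hB : ∀ x y, B x y = B y x) (hBQ : ∀ v, B v v = Q v) (hn : NondegenerateOn B ⊤)
    {g : (CliffordAlgebra Q)ˣ} (hg : g ∈ GSpin Q) :
    ∃ T : V ≃ₗ[F] V, (∀ v, (g : CliffordAlgebra Q) * ι Q v = ι Q (T v) * g) ∧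
      ∀ x y, B (T x) (T y) = B x y := by
  have := nontrivial_cliffordAlgebra h2 Q
  have hinj := ι_injective_of_nondegenerateOn h2 hB hBQ hn
  obtain ⟨-, -, hg3⟩ := hg
  have hex : ∀ v, ∃ w, (g : CliffordAlgebra Q) * ι Q v = ι Q w * g := by
    intro v
    have : (g : CliffordAlgebra Q) * ι Q v * ((g⁻¹ : (CliffordAlgebra Q)ˣ) : CliffordAlgebra Q) ∈
        vectors Q := hg3 ▸ ⟨ι Q v, ⟨v, rfl⟩, rfl⟩
    obtain ⟨w, hw⟩ := this
    exact ⟨w, by rw [hw, Units.inv_mul_cancel_right]⟩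
  choose f hf using hex
  have hcancel : ∀ x y, ι Q x * g = ι Q y * (g : CliffordAlgebra Q) → x = y := fun x y h =>
    hinj (g.mul_left_inj.1 h)
  let f' : V →ₗ[F] V :=
    { toFun := f
      map_add' := fun x y => hcancel _ _ (by
        rw [← hf, map_add, map_add, mul_add, hf, hf, add_mul])
      map_smul' := fun c x => hcancel _ _ (by
        rw [← hf, map_smul, RingHom.id_apply, map_smul, mul_smul_comm, hf, smul_mul_assoc]) }
  have hf'inj : Function.Injective f' := by
    intro x y hxy
    have hxy' : f x = f y := hxy
    have : (g : CliffordAlgebra Q) * ι Q x = g * ι Q y := by rw [hf, hf, hxy']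
    exact hinj (g.mul_right_inj.1 this)
  refine ⟨LinearEquiv.ofInjectiveEndo f' hf'inj, hf, fun x y => ?_⟩
  have hfx : ∀ x, (LinearEquiv.ofInjectiveEndo f' hf'inj) x = f x := fun x => rfl
  rw [hfx, hfx]
  -- The form is recovered from anticommutators of vectors, which conjugation by `g` preserves.
  have h1 : ∀ a b, algebraMap F (CliffordAlgebra Q) (2 * B a b) =
      ι Q a * ι Q b + ι Q b * ι Q a := fun a b => by rw [ι_mul_ι_eq hB hBQ a b]; abel
  have h3 : algebraMap F (CliffordAlgebra Q) (2 * B (f x) (f y)) =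
      algebraMap F (CliffordAlgebra Q) (2 * B x y) := by
    refine g.mul_left_inj.1 ?_
    rw [h1, Algebra.commutes, h1]
    simp only [add_mul, mul_add, mul_assoc]
    rw [← hf, ← hf]
    simp only [← mul_assoc]
    rw [← hf, ← hf]
  exact mul_left_cancel₀ h2 ((algebraMap F (CliffordAlgebra Q)).injective h3)

theorem isSemisimple_mulRight_reverse [FiniteDimensional F V] (h2 : (2 : F) ≠ 0)
    {x : CliffordAlgebra Q} (h : Module.End.IsSemisimple (LinearMap.mulLeft F x)) :
    Module.End.IsSemisimple (LinearMap.mulRight F (reverse x)) := by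
  have := finiteDimensional_cliffordAlgebra h2 Q
  refine (LinearEquiv.isSemisimple_iff (LinearMap.mulLeft F x) (LinearMap.mulRight F (reverse x))
    (reverseEquiv (Q := Q)) ?_).1 h
  ext y
  simp [reverse.map_mul]

/-- The map `x ↦ g x g*` is a product of commuting semisimple operators, hence semisimple over a
perfect field. As `g g*` is a nonzero scalar `c`, it acts on vectors as `c T`. -/
theorem isSemisimple_of_isSemisimple_mulLeft [PerfectField F] [FiniteDimensional F V]
    (h2 : (2 : F) ≠ 0)
    (hB : ∀ x y, B x y = B y x) (hBQ : ∀ v, B v v = Q v) (hn : NondegenerateOn B ⊤)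
    {g : (CliffordAlgebra Q)ˣ} (hg : involute (g : CliffordAlgebra Q) = g) {T : V ≃ₗ[F] V}
    (hT : ∀ v, (g : CliffordAlgebra Q) * ι Q v = ι Q (T v) * g)
    (hss : Module.End.IsSemisimple (LinearMap.mulLeft F (g : CliffordAlgebra Q))) :
    Module.End.IsSemisimple (T : V →ₗ[F] V) := by
  have := finiteDimensional_cliffordAlgebra h2 Q
  have hinj := ι_injective_of_nondegenerateOn h2 hB hBQ hn
  have hTr : ∀ v, reverse (g : CliffordAlgebra Q) * ι Q (T v) =
      ι Q v * reverse (g : CliffordAlgebra Q) := by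
    intro v
    simpa [reverse.map_mul] using (congrArg reverse (hT v)).symm
  have hφ := Module.End.IsSemisimple.mul_of_commute
    (LinearMap.commute_mulLeft_right (R := F) (g : CliffordAlgebra Q)
      (reverse (g : CliffordAlgebra Q))) hss (isSemisimple_mulRight_reverse h2 hss)
  obtain ⟨c, hc⟩ := exists_eq_algebraMap_of_twisted_commute h2 hB hBQ hn
    (x := (g : CliffordAlgebra Q) * reverse (g : CliffordAlgebra Q)) fun v => by
      obtain ⟨w, rfl⟩ := T.surjective v
      rw [map_mul, ← reverse_involute, hg, mul_assoc, hTr, ← mul_assoc, hT, mul_assoc]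
  have := nontrivial_cliffordAlgebra h2 Q
  have hc0 : c ≠ 0 := by
    rintro rfl
    rw [map_zero] at hc
    have h1 : IsUnit ((g * starUnit g : (CliffordAlgebra Q)ˣ) : CliffordAlgebra Q) := Units.isUnit _
    rw [Units.val_mul,
      show (starUnit g : CliffordAlgebra Q) = reverse (g : CliffordAlgebra Q) from rfl, hc] at h1
    exact not_isUnit_zero h1
  set φ := LinearMap.mulLeft F (g : CliffordAlgebra Q) *
    LinearMap.mulRight F (reverse (g : CliffordAlgebra Q))
  have hφι : ∀ v, φ (ι Q v) = c • ι Q (T v) := by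
    intro v
    change (g : CliffordAlgebra Q) * (ι Q v * reverse (g : CliffordAlgebra Q)) = _
    rw [← mul_assoc, hT, mul_assoc, hc, ← Algebra.commutes, Algebra.smul_def]
  rw [Module.End.isSemisimple_iff] at hφ ⊢
  intro p hp
  -- An invariant complement of `ι(p)` in the whole Clifford algebra, pulled back to V, is a
  -- complement of `p`.
  obtain ⟨q, hq, hpq⟩ := hφ (p.map (ι Q)) (by
    rintro _ ⟨v, hv, rfl⟩
    rw [Submodule.mem_comap, hφι]
    exact Submodule.smul_mem _ _ ⟨T v, hp hv, rfl⟩)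
  refine ⟨q.comap (ι Q), ?_, ?_⟩
  · intro v hv
    have h1 : c • ι Q (T v) ∈ q := hφι v ▸ hq hv
    exact (Submodule.smul_mem_iff q hc0).1 h1
  · refine ⟨Submodule.disjoint_def.2 fun x hx hx' => ?_, codisjoint_iff.2 (eq_top_iff.2 fun v _ => ?_)⟩
    · have := (Submodule.disjoint_def.1 hpq.disjoint) (ι Q x) ⟨x, hx, rfl⟩ hx'
      exact hinj (by rw [this, map_zero])
    · have hv : ι Q v ∈ p.map (ι Q) ⊔ q := hpq.sup_eq_top ▸ Submodule.mem_top
      obtain ⟨_, ⟨x, hx, rfl⟩, y, hy, hxy⟩ := Submodule.mem_sup.1 hv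
      refine Submodule.mem_sup.2 ⟨x, hx, v - x, ?_, by abel⟩
      rw [Submodule.mem_comap, map_sub, ← hxy, add_sub_cancel_left]
      exact hy

theorem even_length_of_involute_eq (h2 : (2 : F) ≠ 0) {l : List V}
    (h0 : vecProd Q l ≠ 0) (h : involute (vecProd Q l) = vecProd Q l) : Even l.length := by
  by_contra ho
  rw [Nat.not_even_iff_odd] at ho
  rw [involute_vecProd, ho.neg_one_pow, neg_smul, one_smul, neg_eq_iff_add_eq_zero,
    ← two_smul F] at h
  exact h0 ((smul_eq_zero.1 h).resolve_left h2)

/-- A semisimple element `g` of `GSpin(V)` is conjugate to `g^*` by a product of `k` pairwise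
orthogonal anisotropic vectors. -/
theorem exists_vecProd_mul_reverse [PerfectField F] [FiniteDimensional F V] (h2 : (2 : F) ≠ 0)
    (hB : ∀ x y, B x y = B y x) (hBQ : ∀ v, B v v = Q v) (hn : NondegenerateOn B ⊤)
    {g : (CliffordAlgebra Q)ˣ} (hg : g ∈ GSpin Q)
    (hss : Module.End.IsSemisimple (LinearMap.mulLeft F (g : CliffordAlgebra Q))) :
    ∃ a : List V, (∀ x ∈ a, Q x ≠ 0) ∧ a.length = halfDim F V ∧
      vecProd Q a * reverse (g : CliffordAlgebra Q) = g * vecProd Q a := by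
  have := nontrivial_cliffordAlgebra h2 Q
  have hgα : involute (g : CliffordAlgebra Q) = g := involute_eq_of_mem_even hg.1
  obtain ⟨T, hT, hiso⟩ := exists_isometry_of_mem_GSpin h2 hB hBQ hn hg
  have hTss := isSemisimple_of_isSemisimple_mulLeft h2 hB hBQ hn hgα hT hss
  obtain ⟨m, r, p, hd, hf⟩ :=
    exists_hasInvolutionFactors h2 hB hiso hTss ⊤ hn fun _ _ => trivial
  rw [finrank_top] at hd
  have hform : ∀ a b : List V, (∀ x ∈ a, B x x ≠ 0) → (∀ x ∈ b, B x x ≠ 0) →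
      (∀ v, reflectProd B a (reflectProd B b v) = T v) →
      ∃ c : F, (g : CliffordAlgebra Q) = c • vecProd Q (a ++ b) := by
    intro a b ha hb hab
    refine exists_eq_smul_vecProd h2 hB hBQ hn (l := a ++ b) (fun x hx => ?_) fun v => ?_
    · exact (List.mem_append.1 hx).elim (ha x) (hb x)
    · rw [hgα, hT, reflectProd_append, hab]
  -- With `s = j = 0` the element `g` is a multiple of a product of `2m + r` vectors, and `g` is
  -- even.
  have hr : Even r := by
    obtain ⟨a, b, ha, hb, -, -, hal, hbl, hab⟩ := hf 0 (zero_le) 0 (zero_le)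
    obtain ⟨c, hc⟩ := hform a b (fun x hx => (ha x hx).2) (fun x hx => (hb x hx).2)
      fun v => hab v trivial
    have hne : c • vecProd Q (a ++ b) ≠ 0 := hc ▸ g.ne_zero
    have hc0 : c ≠ 0 := fun h => hne (by rw [h, zero_smul])
    have hω0 : vecProd Q (a ++ b) ≠ 0 := fun h => hne (by rw [h, smul_zero])
    rw [hc, map_smul] at hgα
    have := even_length_of_involute_eq h2 hω0 (smul_right_injective _ hc0 hgα)
    rw [List.length_append, hal, hbl] at this
    grind
  obtain ⟨t, rfl⟩ := hr
  -- Half of the (-1)-lines go to each factor. Rounding `p / 2` up gives both lists length `m + t +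
  -- (p + 1) / 2 = k`.
  obtain ⟨a, b, ha, hb, hap, hbp, hal, hbl, hab⟩ := hf t (by lia) ((p + 1) / 2) (by lia)
  refine ⟨a, fun x hx => by rw [← hBQ]; exact (ha x hx).2, by rw [hal, halfDim, ← hd]; lia, ?_⟩
  obtain ⟨c, hc⟩ := hform a b (fun x hx => (ha x hx).2) (fun x hx => (hb x hx).2)
    fun v => hab v trivial
  have hlen : b.length = a.length := by lia
  have hs : ((-1 : F) ^ (a.length.choose 2)) * (-1 : F) ^ (a.length.choose 2) = 1 := by
    rw [← mul_pow]; simp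
  -- Equal lengths give equal reversal signs, which cancel: `g* = c B A`, so `A g* = c A B A = g A`.
  rw [hc, map_smul, vecProd_append, reverse.map_mul, reverse_vecProd hB hBQ a hap,
    reverse_vecProd hB hBQ b hbp, hlen, smul_mul_smul_comm, hs, one_smul, mul_smul_comm,
    smul_mul_assoc, mul_assoc]

theorem exists_GPin_eq_vecProd (l : List V) (hl : ∀ a ∈ l, Q a ≠ 0) :
    ∃ u : GPin Q, ((u : (CliffordAlgebra Q)ˣ) : CliffordAlgebra Q) = vecProd Q l := by
  induction l with
  | nil => exact ⟨1, by simp⟩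
  | cons a l ih =>
    obtain ⟨u, hu⟩ := ih fun x hx => hl x (by simp [hx])
    refine ⟨vec a (hl a (by simp)) * u, ?_⟩
    rw [Subgroup.coe_mul, Units.val_mul, hu, vecProd_cons]
    rfl

theorem mem_even_of_involute_eq (h2 : (2 : F) ≠ 0) {x : CliffordAlgebra Q}
    (h : involute x = x) : x ∈ even Q := by
  have hx : x ∈ evenOdd Q 0 ⊔ evenOdd Q 1 := (evenOdd_isCompl Q).sup_eq_top ▸ Submodule.mem_top
  obtain ⟨y, hy, z, hz, rfl⟩ := Submodule.mem_sup.1 hx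
  rw [map_add, involute_eq_of_mem_even hy, involute_eq_of_mem_odd hz, add_right_inj,
    neg_eq_iff_add_eq_zero, ← two_smul F] at h
  rw [(smul_eq_zero.1 h).resolve_left h2, add_zero]
  exact hy

theorem mem_GSpinInGPin_of_involute_eq (h2 : (2 : F) ≠ 0) {u : GPin Q}
    (h : involute ((u : (CliffordAlgebra Q)ˣ) : CliffordAlgebra Q) = (u : (CliffordAlgebra Q)ˣ)) :
    u ∈ GSpinInGPin Q := by
  obtain ⟨u, hu⟩ := u
  change involute (u : CliffordAlgebra Q) = u at h
  change u ∈ GSpin Q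
  have h' : involute ((u⁻¹ : (CliffordAlgebra Q)ˣ) : CliffordAlgebra Q) =
      (u⁻¹ : (CliffordAlgebra Q)ˣ) := by
    refine u.mul_right_inj.1 ?_
    rw [Units.mul_inv]
    nth_rw 1 [← h]
    rw [← map_mul, Units.mul_inv, map_one]
  refine ⟨mem_even_of_involute_eq h2 h, mem_even_of_involute_eq h2 h', ?_⟩
  have hu' : twistedConj u '' vectors Q = vectors Q := hu
  conv_rhs => rw [← hu']
  refine Set.image_congr fun x _ => ?_
  rw [twistedConj, h]

theorem coe_sigma_of_mem {g : GPin Q} (hg : g ∈ GSpinInGPin Q) :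
    ((sigma g : (CliffordAlgebra Q)ˣ) : CliffordAlgebra Q) =
      reverse ((g : (CliffordAlgebra Q)ˣ) : CliffordAlgebra Q) := by
  have hs : sign g = 1 := if_pos hg
  rw [sigma]
  split_ifs
  · rfl
  · simp only [hs, one_pow, signUnit, map_one, one_mul]
    rfl

theorem involute_vec_pow (e : V) (he : Q e ≠ 0) (k : ℕ) :
    involute (((vec e he ^ k : GPin Q) : (CliffordAlgebra Q)ˣ) : CliffordAlgebra Q) =
      (-1 : F) ^ k • (((vec e he ^ k : GPin Q) : (CliffordAlgebra Q)ˣ) : CliffordAlgebra Q) := by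
  have : (((vec e he ^ k : GPin Q) : (CliffordAlgebra Q)ˣ) : CliffordAlgebra Q) =
      vecProd Q (List.replicate k e) := by
    rw [vecProd, List.map_replicate, List.prod_replicate]
    simp only [SubmonoidClass.coe_pow, Units.val_pow_eq_pow_val]
    rfl
  rw [this, involute_vecProd, List.length_replicate]

/-- In odd dimension there is an odd central element of the Clifford algebra which lies in
`GPin(V)`. -/
theorem exists_odd_central [FiniteDimensional F V] (h2 : (2 : F) ≠ 0)
    (hB : ∀ x y, B x y = B y x) (hBQ : ∀ v, B v v = Q v) (hn : NondegenerateOn B ⊤)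
    (hodd : Odd (Module.finrank F V)) :
    ∃ z : GPin Q, involute ((z : (CliffordAlgebra Q)ˣ) : CliffordAlgebra Q) =
        -((z : (CliffordAlgebra Q)ˣ) : CliffordAlgebra Q) ∧
      ∀ x, ((z : (CliffordAlgebra Q)ˣ) : CliffordAlgebra Q) * x =
        x * ((z : (CliffordAlgebra Q)ˣ) : CliffordAlgebra Q) := by
  obtain ⟨l, hl, hlp, hlen, hspan⟩ := exists_orthogonal_list h2 hB hn
  rw [finrank_top] at hlen
  obtain ⟨z, hz⟩ := exists_GPin_eq_vecProd (Q := Q) l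
    fun a ha => by rw [← hBQ]; exact (hl a ha).2
  have hinv : involute (vecProd Q l) = -vecProd Q l := by
    rw [involute_vecProd, hlen, hodd.neg_one_pow, neg_smul, one_smul]
  refine ⟨z, by rw [hz, hinv], fun x => ?_⟩
  rw [hz]
  induction x using CliffordAlgebra.induction with
  | algebraMap r => rw [Algebra.commutes]
  | ι v =>
    -- Reflecting along a full orthogonal basis gives -1, which cancels the sign of the odd element
    -- `z` in the twisted relation.
    have hR : reflectProd B l v = -v := by
      have hv : v ∈ Submodule.span F {a | a ∈ l} := hspan ▸ Submodule.mem_top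
      induction hv using Submodule.span_induction with
      | mem x hx => exact reflectProd_of_mem hB (fun a ha => (hl a ha).2) hlp hx
      | zero => simp
      | add x y _ _ hx hy => rw [map_add, hx, hy, neg_add]
      | smul c x _ hx => rw [map_smul, hx, smul_neg]
    have := involute_vecProd_mul_ι hB hBQ l (fun a ha => (hl a ha).2) v
    rwa [hinv, hR, map_neg, neg_mul, neg_mul, neg_inj] at this
  | mul a b ha hb => rw [← mul_assoc, ha, mul_assoc, hb, mul_assoc]
  | add a b ha hb => rw [mul_add, ha, hb, add_mul]

end CliffordGroup

end CliffordGroups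

end

/-! ### Correcting the parity of the conjugator -/

theorem corollary3 {F : Type*} [Field F] [ValuativeRel F] [TopologicalSpace F]
    [IsNonarchimedeanLocalField F] [CharZero F]
    {V : Type*} [AddCommGroup V] [Module F V] [FiniteDimensional F V]
    (Q : QuadraticForm F V) (hQ : (QuadraticMap.associated (R := F) Q).Nondegenerate)
    (g : CliffordGroups.GPin Q) (hg : g ∈ CliffordGroups.GSpinInGPin Q)
    (hss : CliffordGroups.IsSemisimpleElt g) :
    (∀ (e : V) (he : Q e ≠ 0), ∃ η ∈ CliffordGroups.GSpinInGPin Q,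
      η * (CliffordGroups.vec e he ^ CliffordGroups.halfDim F V * CliffordGroups.sigma g *
        (CliffordGroups.vec e he ^ CliffordGroups.halfDim F V)⁻¹) * η⁻¹ = g) ∧
    (Odd (Module.finrank F V) →
      ∃ η ∈ CliffordGroups.GSpinInGPin Q, η * CliffordGroups.sigma g * η⁻¹ = g) := by
  have h2 : (2 : F) ≠ 0 := two_ne_zero
  have hB : ∀ x y, QuadraticMap.associated (R := F) Q x y =
      QuadraticMap.associated (R := F) Q y x := QuadraticMap.associated_isSymm F Q
  have hBQ : ∀ v, QuadraticMap.associated (R := F) Q v v = Q v :=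
    QuadraticMap.associated_eq_self_apply F Q
  have hn : CliffordGroups.NondegenerateOn (QuadraticMap.associated (R := F) Q) ⊤ :=
    fun x _ h => hQ.1 x fun y => h y trivial
  obtain ⟨a, ha, hal, hga⟩ :=
    CliffordGroups.exists_vecProd_mul_reverse h2 hB hBQ hn
      (g := (g : (CliffordAlgebra Q)ˣ)) hg hss
  obtain ⟨u, hu⟩ := CliffordGroups.exists_GPin_eq_vecProd a ha
  have huα : CliffordAlgebra.involute ((u : (CliffordAlgebra Q)ˣ) : CliffordAlgebra Q) =
      (-1 : F) ^ CliffordGroups.halfDim F V • ((u : (CliffordAlgebra Q)ˣ) : CliffordAlgebra Q) := by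
    rw [hu, CliffordGroups.involute_vecProd, hal]
  have hug : u * CliffordGroups.sigma g = g * u := by
    refine Subtype.ext (Units.ext ?_)
    rw [Subgroup.coe_mul, Subgroup.coe_mul, Units.val_mul, Units.val_mul,
      CliffordGroups.coe_sigma_of_mem hg, hu, hga]
  refine ⟨fun e he => ?_, fun hodd => ?_⟩
  · set E := CliffordGroups.vec e he ^ CliffordGroups.halfDim F V with hE
    have hEα := CliffordGroups.involute_vec_pow e he (CliffordGroups.halfDim F V)
    rw [← hE] at hEα
    -- Both `u` and `E = e^k` have parity k, so the quotient is even; the factors `E` then cancel in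
    -- the conjugation.
    refine ⟨u * E⁻¹, CliffordGroups.mem_GSpinInGPin_of_involute_eq h2 ?_, ?_⟩
    · have h1 : (((u * E⁻¹ : CliffordGroups.GPin Q) : (CliffordAlgebra Q)ˣ) : CliffordAlgebra Q) *
          ((E : (CliffordAlgebra Q)ˣ) : CliffordAlgebra Q) = (u : (CliffordAlgebra Q)ˣ) := by
        rw [← Units.val_mul, ← Subgroup.coe_mul, inv_mul_cancel_right]
      have h3 := congrArg CliffordAlgebra.involute h1
      rw [map_mul, hEα, huα, mul_smul_comm, ← h1] at h3
      exact (E : (CliffordAlgebra Q)ˣ).mul_left_inj.1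
        (smul_right_injective _ (pow_ne_zero _ (neg_ne_zero.2 one_ne_zero)) h3)
    · calc u * E⁻¹ * (E * CliffordGroups.sigma g * E⁻¹) * (u * E⁻¹)⁻¹
          = u * CliffordGroups.sigma g * u⁻¹ := by group
        _ = g := by rw [hug, mul_inv_cancel_right]
  · rcases Nat.even_or_odd (CliffordGroups.halfDim F V) with hk | hk
    · refine ⟨u, CliffordGroups.mem_GSpinInGPin_of_involute_eq h2 ?_, ?_⟩
      · rw [huα, hk.neg_one_pow, one_smul]
      · rw [hug, mul_inv_cancel_right]
    · obtain ⟨z, hzα, hz⟩ := CliffordGroups.exists_odd_central h2 hB hBQ hn hodd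
      have hzc : z * CliffordGroups.sigma g = CliffordGroups.sigma g * z :=
        Subtype.ext (Units.ext (hz _))
      refine ⟨u * z, CliffordGroups.mem_GSpinInGPin_of_involute_eq h2 ?_, ?_⟩
      · rw [Subgroup.coe_mul, Units.val_mul, map_mul, huα, hzα, hk.neg_one_pow, neg_smul, one_smul,
          neg_mul_neg]
      · rw [mul_assoc u, hzc, ← mul_assoc, hug, mul_assoc g, mul_inv_cancel_right]
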